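/- Let $k$ be a field of characteristic $0$. Consider the following recursive algorithm FiberClassification. Its input is $(X,Y,U)$ with a closed subscheme $X=V(I)\subseteq\mathbb A^{m+n}_k=\operatorname{Spec}k[\mathbf y,\mathbf x]$, an integral closed subscheme $Y=V(J)\subseteq\mathbb A^n_k=\operatorname{Spec}k[\mathbf y]$ such that the projection $\pi:\mathbb A^{m+n}_k\to\mathbb A^n_k$ induces a morphism $X\to Y$, and a distinguished open subset $U=D(h)$ of $X$, $h\in k[\mathbf y,\mathbf x]$. Irreducible components carry the reduced induced structure, and for a closed $C\subseteq Y$ the "call on $C$" is the recursive call on $(\pi^{-1}(C)\cap X,\,C,\,\pi^{-1}(C)\cap U)$. 1. If $X=\varnothing$, return the empty list. 2. If $\overline{\pi(X)}\ne Y$, return the union of the results of the calls on the irreducible components of $\overline{\pi(X)}$. 3. Otherwise choose a non-zero $w\in\Gamma(Y,\mathcal O_Y)$ such that $B=\Gamma(\pi^{-1}(D(w)),\mathcal O_X)$ is a free module over $A=\Gamma(D(w),\mathcal O_Y)$. - (a) If the fiber of $X\to Y$ over the generic point of $Y$ is infinite and $U=X$, return the pair $(D(w),+\infty)$ together with the results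 of the calls on the irreducible components of $V(w)\subseteq Y$. - (b) If this fiber is infinite and $U\neq X$, return the result of the recursive call on $(X',Y,X')$, where $X'=V(zh-1)\subseteq\mathbb A^1_X\subseteq\mathbb A^{m+1+n}_k$ and $z$ is a new variable. - (c) If this fiber is finite, choose a basis $b_1,\dots,b_s$ of $B$ over $A$, let $H_h=(\operatorname{tr}_{B/A}(b_ihb_j))_{i,j}$, let $I_i\subseteq A$ be the ideal generated by the $i$-minors of $H_h$ ($0\le i\le s$), $I_{s+1}=(0)$, and return the pairs $\bigl(D(w)\cap(V(I_{i+1})\setminus V(I_i)),\,i\bigr)$, $i=1,\dots,s$, together with the results of the calls on the irreducible components of $V(w)\subseteq Y$. For $y\in Y$ let $\#U_{\overline y}\in\{0,1,2,\dots,+\infty\}$ be the number of points of the geometric fiber $U_{\overline y}=U\times_Y\operatorname{Spec}\overline{\kappa_y}$, where $\overline{\kappa_y}$ is an algebraic closure of the residue field of $y$. **Theorem.** On every such input and for all choices, the algorithm terminates: there is no infinite run, and the choices that it prescribes always exist. Every result that it returns is a finite list of pairs $(C,r)$ such that - each $C$ is a locally closed subset of $Y$, and $\#U_{\overline y}=r$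 for all $y\in C$; - the union of all the sets $C$ is $\pi(U)$; - hence, for $0<l\le+\infty$, the region $\{y\in Y:\#U_{\overline y}=l\}$ is the union of the sets $C$ with label $r=l$, and $\{y\in Y:\#U_{\overline y}=0\}$ is the complement in $Y$ of the union of all the sets $C$. In particular the algorithm solves the geometric fiber classification problem for every $k$-morphism $f:X=\operatorname{Spec}B\to Y=\operatorname{Spec}A$ of affine $k$-varieties with $Y$ integral: there are closed immersions $Y\hookrightarrow\mathbb A^n_k$ and $X\hookrightarrow\mathbb A^{m+n}_k$ that are compatible with $f$ and $\pi$, and for any such immersions the algorithm terminates on the resulting input $(X,Y,X)$, and every list that it returns describes, in the above way, the regions $\{y\in Y:\#X_{\overline y}=l\}$ for all $0\le l\le+\infty$. -/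

import Mathlib

open scoped TensorProduct

noncomputable section

namespace FiberClassification

/-- The coordinate ring `k[y₁, …, yₙ]` of `𝔸ⁿ`. -/
abbrev BaseRing (k : Type*) [Field k] (n : ℕ) : Type _ := MvPolynomial (Fin n) k

/-- The coordinate ring `k[y₁, …, yₙ][x₁, …, xₘ]` of `𝔸ᵐ⁺ⁿ`.  The projection
`π : 𝔸ᵐ⁺ⁿ → 𝔸ⁿ` is the morphism of spectra induced by `MvPolynomial.C`. -/
abbrev TotalRing (k : Type*) [Field k] (n m : ℕ) : Type _ := MvPolynomial (Fin m) (BaseRing k n)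

/-- For a morphism `Spec B → Spec A` and a point `y` of `Spec A`, the cardinality (possibly `⊤`,
that is `+∞`) of the geometric fiber `Spec (B ⊗[A] K)`, where `K` is the algebraic closure of the
residue field of `y`. -/
def geomFiberCard (A B : Type*) [CommRing A] [CommRing B] [Algebra A B] (y : PrimeSpectrum A) :
    ℕ∞ :=
  ENat.card (PrimeSpectrum (B ⊗[A] AlgebraicClosure y.asIdeal.ResidueField))

/-- `Ps` lists, without repetition, the vanishing ideals of the irreducible components (the
maximal irreducible subsets) of the subset `Z` of `Spec A`.  So `Spec (A ⧸ P)`, for `P ∈ Ps`, are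
the irreducible components of `Z` with their reduced induced structure. -/
def IsComponentList {A : Type*} [CommRing A] (Z : Set (PrimeSpectrum A)) (Ps : List (Ideal A)) :
    Prop :=
  Ps.Nodup ∧ ∀ P : Ideal A, P ∈ Ps ↔
    ∃ C : Set (PrimeSpectrum A),
      Maximal (fun T : Set (PrimeSpectrum A) => IsIrreducible T ∧ T ⊆ Z) C ∧
        P = PrimeSpectrum.vanishingIdeal C

/-- The ideal generated by all `i`-minors of the square matrix `H`. -/
def minorIdeal {A : Type*} [CommRing A] {s : ℕ} (H : Matrix (Fin s) (Fin s) A) (i : ℕ) : Ideal A :=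
  Ideal.span {d | ∃ e f : Fin i ↪o Fin s, d = (H.submatrix e f).det}

/-- The matrix `(tr L_{bᵢ h bⱼ})` of the parametric Hermite quadratic form associated with `h` of
the `A`-algebra `B`, in the basis `b` of `B` over `A`. -/
def hermiteMatrix {A B : Type*} [CommRing A] [CommRing B] [Algebra A B] {s : ℕ}
    (b : Module.Basis (Fin s) A B) (h : B) : Matrix (Fin s) (Fin s) A :=
  Matrix.of fun i j => Algebra.trace A B (b i * h * b j)

/-- The data of a call of the algorithm: closed subschemes `X = V(I)` of `𝔸ᵐ⁺ⁿ` and `Y = V(J)` of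
`𝔸ⁿ` such that the projection `π` induces a morphism `X → Y`, and a function `h` that defines the
distinguished open subset `U = D(h)` of `X`. -/
structure Input (k : Type*) [Field k] (n : ℕ) where
  m : ℕ
  I : Ideal (TotalRing k n m)
  J : Ideal (BaseRing k n)
  h : TotalRing k n m
  le : J ≤ I.comap MvPolynomial.C

namespace Input

variable {k : Type*} [Field k] {n : ℕ} (p : Input k n)

/-- The precondition of the algorithm: `Y` is integral. -/
def Valid : Prop := p.J.IsPrime

/-- The projection `π : 𝔸ᵐ⁺ⁿ → 𝔸ⁿ`. -/
def proj : PrimeSpectrum (TotalRing k n p.m) → PrimeSpectrum (BaseRing k n) :=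
  PrimeSpectrum.comap MvPolynomial.C

/-- The points of `X`. -/
def X : Set (PrimeSpectrum (TotalRing k n p.m)) := PrimeSpectrum.zeroLocus p.I

/-- The points of `Y`. -/
def Y : Set (PrimeSpectrum (BaseRing k n)) := PrimeSpectrum.zeroLocus p.J

/-- The points of `U = D(h) ⊆ X`. -/
def U : Set (PrimeSpectrum (TotalRing k n p.m)) := p.X ∩ PrimeSpectrum.basicOpen p.h

/-- The coordinate ring of `Y`. -/
def RingY : Type _ := BaseRing k n ⧸ p.J

instance : CommRing p.RingY := inferInstanceAs (CommRing (BaseRing k n ⧸ p.J))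

/-- The restriction of functions from `𝔸ⁿ` to `Y`. -/
def toRingY : BaseRing k n →+* p.RingY := Ideal.Quotient.mk p.J

/-- The coordinate ring of `X`. -/
def RingX : Type _ := TotalRing k n p.m ⧸ p.I

instance : CommRing p.RingX := inferInstanceAs (CommRing (TotalRing k n p.m ⧸ p.I))

/-- The restriction of functions from `𝔸ᵐ⁺ⁿ` to `X`. -/
def toRingX : TotalRing k n p.m →+* p.RingX := Ideal.Quotient.mk p.I

instance : Algebra (BaseRing k n) p.RingX := (p.toRingX.comp MvPolynomial.C).toAlgebra

/-- The map on functions that belongs to the morphism `X → Y` induced by the projection. -/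
def morphism : p.RingY →+* p.RingX := Ideal.quotientMap p.I MvPolynomial.C p.le

instance : Algebra p.RingY p.RingX := p.morphism.toAlgebra

/-- The coordinate ring of `U`. -/
abbrev RingU : Type _ := Localization.Away (p.toRingX p.h)

/-- The cardinality of the geometric fiber of `U` over a point `y` of `Y ⊆ 𝔸ⁿ`.  As `Y → 𝔸ⁿ` is a
closed immersion, the fiber product over `Y` is the fiber product over `𝔸ⁿ`, and the residue
fields of `y` on `Y` and on `𝔸ⁿ` agree. -/
def fiberCard (y : PrimeSpectrum (BaseRing k n)) : ℕ∞ := geomFiberCard (BaseRing k n) p.RingU y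

/-- `A = Γ(D(w), 𝒪_Y)`. -/
abbrev RingA (w : p.RingY) : Type _ := Localization (Submonoid.powers w)

/-- `B = Γ(π⁻¹(D(w)), 𝒪_X)`, an algebra over `A = Γ(D(w), 𝒪_Y)`. -/
abbrev RingB (w : p.RingY) : Type _ :=
  Localization (Algebra.algebraMapSubmonoid p.RingX (Submonoid.powers w))

/-- The subset `D(w)` of `Y`. -/
def locusD (w : p.RingY) : Set (PrimeSpectrum (BaseRing k n)) :=
  PrimeSpectrum.comap p.toRingY '' (PrimeSpectrum.basicOpen w)

/-- The subset `V(w)` of `Y`. -/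
def locusV (w : p.RingY) : Set (PrimeSpectrum (BaseRing k n)) :=
  PrimeSpectrum.comap p.toRingY '' (PrimeSpectrum.zeroLocus {w})

/-- A choice of `w` that is admissible for generic freeness: `w ≠ 0` and `B` is free over `A`. -/
def IsFreeAway (w : p.RingY) : Prop := w ≠ 0 ∧ Module.Free (p.RingA w) (p.RingB w)

/-- The fiber of `π : X → Y` over the generic point of `Y` is finite. -/
def GenericallyFinite : Prop := {x | x ∈ p.X ∧ (p.proj x).asIdeal = p.J}.Finite

/-- The restriction `(π⁻¹(C) ∩ X, C, π⁻¹(C) ∩ U)` of the data to the closed subscheme `C = V(P)`. -/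
def restrict (P : Ideal (BaseRing k n)) : Input k n where
  m := p.m
  I := p.I ⊔ P.map MvPolynomial.C
  J := P
  h := p.h
  le := Ideal.map_le_iff_le_comap.mp le_sup_right

/-- The ideal of `X' = V(z h - 1) ⊆ 𝔸¹_X`, where `z` is a new, last variable. -/
def rabinowitschIdeal : Ideal (TotalRing k n (p.m + 1)) :=
  p.I.map (MvPolynomial.rename Fin.castSucc : TotalRing k n p.m →ₐ[BaseRing k n] _) ⊔
    Ideal.span {MvPolynomial.X (Fin.last p.m) * MvPolynomial.rename Fin.castSucc p.h - 1}

theorem le_comap_rabinowitschIdeal : p.J ≤ p.rabinowitschIdeal.comap MvPolynomial.C := by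
  intro f hf
  have h1 := Ideal.mem_map_of_mem
    (MvPolynomial.rename Fin.castSucc : TotalRing k n p.m →ₐ[BaseRing k n]
      TotalRing k n (p.m + 1)) (p.le hf)
  rw [MvPolynomial.rename_C] at h1
  exact Ideal.mem_sup_left h1

/-- The data `(X', Y, X')` of the Rabinowitsch trick. -/
def rabinowitsch : Input k n where
  m := p.m + 1
  I := p.rabinowitschIdeal
  J := p.J
  h := 1
  le := p.le_comap_rabinowitschIdeal

/-- The matrix `H_h` of the parametric Hermite quadratic form of `B` over `A` associated with the
image of `h` in `B`. -/
def hermite (w : p.RingY) {s : ℕ} (b : Module.Basis (Fin s) (p.RingA w) (p.RingB w)) :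
    Matrix (Fin s) (Fin s) (p.RingA w) :=
  hermiteMatrix b (algebraMap p.RingX (p.RingB w) (p.toRingX p.h))

/-- The locally closed subset `D(w) ∩ (V(I_{i+1}) \ V(I_i))` of `Y`, where `I_i` is the ideal of
`A = Γ(D(w), 𝒪_Y)` generated by the `i`-minors of `H_h`, and `Spec A` is identified with `D(w)`. -/
def rankLocus (w : p.RingY) {s : ℕ} (b : Module.Basis (Fin s) (p.RingA w) (p.RingB w)) (i : ℕ) :
    Set (PrimeSpectrum (BaseRing k n)) :=
  PrimeSpectrum.comap ((algebraMap p.RingY (p.RingA w)).comp p.toRingY) ''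
    (PrimeSpectrum.zeroLocus (minorIdeal (p.hermite w b) (i + 1)) \
      PrimeSpectrum.zeroLocus (minorIdeal (p.hermite w b) i))

end Input

/-- A list of pairs `(C, r)`, where `C` is a set of points of `𝔸ⁿ` and `r` is a label. -/
abbrev Output (k : Type*) [Field k] (n : ℕ) : Type _ :=
  List (Set (PrimeSpectrum (BaseRing k n)) × ℕ∞)

/-- One execution of the body of the algorithm: `Body p out calls` says that on the input `p` it
may put the pairs of `out` directly into the result and make exactly the recursive calls `calls`.
The algorithm is free in the choice of `w`, of the basis of `B` over `A`, and of the order of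
irreducible components, so that `Body` is a relation. -/
inductive Body {k : Type*} [Field k] {n : ℕ} (p : Input k n) :
    Output k n → List (Input k n) → Prop
  | empty : p.X = ∅ → Body p [] []
  | notDominant (Ps : List (Ideal (BaseRing k n))) :
      p.X ≠ ∅ → closure (p.proj '' p.X) ≠ p.Y →
      IsComponentList (closure (p.proj '' p.X)) Ps →
      Body p [] (Ps.map p.restrict)
  | infiniteFibers (w : p.RingY) (Ps : List (Ideal (BaseRing k n))) :
      p.X ≠ ∅ → closure (p.proj '' p.X) = p.Y → p.IsFreeAway w →
      ¬ p.GenericallyFinite → p.U = p.X →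
      IsComponentList (p.locusV w) Ps →
      Body p [(p.locusD w, ⊤)] (Ps.map p.restrict)
  | rabinowitsch (w : p.RingY) :
      p.X ≠ ∅ → closure (p.proj '' p.X) = p.Y → p.IsFreeAway w →
      ¬ p.GenericallyFinite → p.U ≠ p.X →
      Body p [] [p.rabinowitsch]
  | finiteFibers (w : p.RingY) (s : ℕ) (b : Module.Basis (Fin s) (p.RingA w) (p.RingB w))
      (Ps : List (Ideal (BaseRing k n))) :
      p.X ≠ ∅ → closure (p.proj '' p.X) = p.Y → p.IsFreeAway w →
      p.GenericallyFinite →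
      IsComponentList (p.locusV w) Ps →
      Body p ((List.range' 1 s).map fun i => (p.rankLocus w b i, (i : ℕ∞))) (Ps.map p.restrict)

/-- A state of the recursive computation: the stack of calls that are still to be executed, and
the list of the pairs that were found so far. -/
structure State (k : Type*) [Field k] (n : ℕ) where
  pending : List (Input k n)
  found : Output k n

/-- One step of the computation: the body is executed for the call on top of the stack. -/
inductive Step {k : Type*} [Field k] {n : ℕ} : State k n → State k n → Prop
  | exec (p : Input k n) (ps calls : List (Input k n)) (found out : Output k n) :
      Body p out calls → Step ⟨p :: ps, found⟩ ⟨calls ++ ps, found ++ out⟩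

/-- The state in which the algorithm is started on the input `p`. -/
def start {k : Type*} [Field k] {n : ℕ} (p : Input k n) : State k n := ⟨[p], []⟩

/-- Some run of the algorithm on the input `p` leads to the state `σ`. -/
def Reaches {k : Type*} [Field k] {n : ℕ} (p : Input k n) (σ : State k n) : Prop :=
  Relation.ReflTransGen Step (start p) σ

/-- Some run of the algorithm on the input `p` ends with the result `out`. -/
def Returns {k : Type*} [Field k] {n : ℕ} (p : Input k n) (out : Output k n) : Prop :=
  Reaches p ⟨[], out⟩

/-- The algorithm terminates on the input `p`: there is no infinite run, and no run gets stuck,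
that is, as long as calls are pending, the choices that the algorithm prescribes exist. -/
def Terminates {k : Type*} [Field k] {n : ℕ} (p : Input k n) : Prop :=
  (¬ ∃ run : ℕ → State k n, run 0 = start p ∧ ∀ i, Step (run i) (run (i + 1))) ∧
    ∀ σ : State k n, Reaches p σ → σ.pending ≠ [] → ∃ τ, Step σ τ

/-- The union of the sets in `out` with label `l`. -/
def labelled {k : Type*} [Field k] {n : ℕ} (out : Output k n) (l : ℕ∞) :
    Set (PrimeSpectrum (BaseRing k n)) :=
  {y | ∃ c ∈ out, c.2 = l ∧ y ∈ c.1}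

/-- The union of all sets in `out`. -/
def covered {k : Type*} [Field k] {n : ℕ} (out : Output k n) : Set (PrimeSpectrum (BaseRing k n)) :=
  {y | ∃ c ∈ out, y ∈ c.1}

/-- An embedding of a morphism `Spec B → Spec A` of affine `k`-varieties into the projection
`𝔸ᵐ⁺ⁿ → 𝔸ⁿ`: closed immersions `Spec A → 𝔸ⁿ` and `Spec B → 𝔸ᵐ⁺ⁿ` that are compatible with the
morphism and the projection. -/
structure Embedding (k A B : Type*) [Field k] [CommRing A] [CommRing B] [Algebra k A] [Algebra k B]
    [Algebra A B] (n m : ℕ) where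
  α : BaseRing k n →ₐ[k] A
  β : TotalRing k n m →ₐ[k] B
  surjective_α : Function.Surjective α
  surjective_β : Function.Surjective β
  comm : ∀ f, β (MvPolynomial.C f) = algebraMap A B (α f)

/-- The input `(X, Y, X)` of the algorithm for an embedded morphism `X = Spec B → Y = Spec A`. -/
def Embedding.input {k A B : Type*} [Field k] [CommRing A] [CommRing B] [Algebra k A] [Algebra k B]
    [Algebra A B] {n m : ℕ} (e : Embedding k A B n m) : Input k n where
  m := m
  I := RingHom.ker e.β
  J := RingHom.ker e.α
  h := 1
  le := fun f hf => by
    have hf' : e.α f = 0 := hf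
    change e.β (MvPolynomial.C f) = 0
    rw [e.comm, hf', map_zero]

end FiberClassification

end

/-! Geometric fibers are counted by points: over an algebraically closed field `L`, a finitely
generated algebra has as many primes as `L`-points, with `⊤` on both sides if there are infinitely
many. So `#U` over `y` is the number of solutions of `I` with `h ≠ 0` in the algebraic closure of
the residue field. Restricting to a closed `C` containing `y` adds only equations that already hold
over `y`, and the Rabinowitsch variable is forced to be `h⁻¹`. Hence every recursive call sees the
same fiber counts as its caller.

Generic freeness (`exists_free_localization`) supplies `w`. Since a basis of `B` over `A` stays a
basis in every fiber, finiteness of the generic fiber decides whether the rank is finite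
(`genericallyFinite_iff`). If the rank is infinite, every fiber over `D(w)` has an
infinite-dimensional algebra, hence infinitely many points (`infinite_algHom`). If it is finite, the
number of points with `h ≠ 0` is the rank of the trace form twisted by `h`
(`card_algHom_eq_rank_hermiteMatrix`), where characteristic `0` enters; minors cut out the loci of
constant rank.

A call on a component of a closed set missing the generic point of `Y` strictly enlarges `J`; the
Rabinowitsch call keeps `J` but reaches `U = X`. This is a lexicographic descent, well-founded
because the polynomial ring is Noetherian, and the multiset of sizes of the pending calls descends
with it (`Step.cutExpand`). Correctness is the invariant `State.Sound`: once no call is pending, all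
points with nonempty fiber are covered. -/

noncomputable section

namespace FiberClassification

/-! ### Irreducible components of closed subsets -/

section Components

variable {A : Type*} [CommRing A]

/-- A closed subset of a Noetherian space has finitely many maximal irreducible subsets, and
they cover it. -/
theorem finite_maximal_irreducible {T : Type*} [TopologicalSpace T]
    [TopologicalSpace.NoetherianSpace T] {Z : Set T} (hZ : IsClosed Z) :
    {C : Set T | Maximal (fun D : Set T => IsIrreducible D ∧ D ⊆ Z) C}.Finite ∧
      ∀ z ∈ Z, ∃ C : Set T, Maximal (fun D : Set T => IsIrreducible D ∧ D ⊆ Z) C ∧ z ∈ C := by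
  obtain ⟨S, hSf, hSc, hSi, rfl⟩ :=
    TopologicalSpace.NoetherianSpace.exists_finite_set_isClosed_irreducible hZ
  have key : ∀ D : Set T, IsIrreducible D → D ⊆ ⋃₀ S → ∃ t ∈ S, D ⊆ t := by
    intro D hD hDS
    obtain ⟨t, ht, hDt⟩ := isIrreducible_iff_sUnion_isClosed.1 hD hSf.toFinset
      (fun z hz => hSc z (by simpa using hz)) (by simpa using hDS)
    exact ⟨t, by simpa using ht, hDt⟩
  refine ⟨hSf.subset fun C hC => ?_, fun z hz => ?_⟩
  · obtain ⟨t, ht, hCt⟩ := key C hC.1.1 hC.1.2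
    rwa [hCt.antisymm (hC.2 ⟨hSi t ht, Set.subset_sUnion_of_mem ht⟩ hCt)]
  · obtain ⟨t, ht, hzt⟩ := hz
    obtain ⟨M, htM, hM⟩ := hSf.exists_le_maximal ht
    refine ⟨M, ⟨⟨hSi M hM.1, Set.subset_sUnion_of_mem hM.1⟩, fun D hD hMD => ?_⟩, htM hzt⟩
    obtain ⟨u, hu, hDu⟩ := key D hD.1 hD.2
    exact hDu.trans (hM.2 hu (hMD.trans hDu))

theorem exists_isComponentList [IsNoetherianRing A] {Z : Set (PrimeSpectrum A)} (hZ : IsClosed Z) :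
    ∃ Ps : List (Ideal A), IsComponentList Z Ps := by
  have hf := (finite_maximal_irreducible hZ).1.image PrimeSpectrum.vanishingIdeal
  refine ⟨hf.toFinset.toList, Finset.nodup_toList _, fun P => ?_⟩
  simp only [Finset.mem_toList, Set.Finite.mem_toFinset, Set.mem_image, Set.mem_ofPred_eq]
  exact exists_congr fun C => and_congr Iff.rfl eq_comm

theorem IsComponentList.isPrime {Z : Set (PrimeSpectrum A)} {Ps : List (Ideal A)}
    (h : IsComponentList Z Ps) {P : Ideal A} (hP : P ∈ Ps) : P.IsPrime := by
  obtain ⟨C, hC, rfl⟩ := (h.2 P).1 hP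
  exact (PrimeSpectrum.isIrreducible_iff_vanishingIdeal_isPrime).1 hC.1.1

theorem IsComponentList.zeroLocus_subset {Z : Set (PrimeSpectrum A)} (hZ : IsClosed Z)
    {Ps : List (Ideal A)} (h : IsComponentList Z Ps) {P : Ideal A} (hP : P ∈ Ps) :
    PrimeSpectrum.zeroLocus (P : Set A) ⊆ Z := by
  obtain ⟨C, hC, rfl⟩ := (h.2 P).1 hP
  rw [PrimeSpectrum.zeroLocus_vanishingIdeal_eq_closure]
  exact hZ.closure_subset_iff.2 hC.1.2

theorem IsComponentList.exists_mem [IsNoetherianRing A] {Z : Set (PrimeSpectrum A)}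
    (hZ : IsClosed Z)
    {Ps : List (Ideal A)} (h : IsComponentList Z Ps) {z : PrimeSpectrum A} (hz : z ∈ Z) :
    ∃ P ∈ Ps, z ∈ PrimeSpectrum.zeroLocus (P : Set A) := by
  obtain ⟨C, hC, hzC⟩ := (finite_maximal_irreducible hZ).2 z hz
  refine ⟨_, (h.2 _).2 ⟨C, hC, rfl⟩, ?_⟩
  rw [PrimeSpectrum.zeroLocus_vanishingIdeal_eq_closure]
  exact subset_closure hzC

end Components

/-! ### Rank and minors -/

section Minors

variable {K : Type*} [Field K]

/-- Some of the rows form a basis of the row space; any `i` of them stay independent, and sorting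
their indices gives the order embedding by which minors are indexed. -/
theorem exists_orderEmbedding_rank_submatrix {s : ℕ} {n : Type*} [Fintype n]
    (M : Matrix (Fin s) n K) {i : ℕ} (hi : i ≤ M.rank) :
    ∃ e : Fin i ↪o Fin s, (M.submatrix e id).rank = i := by
  classical
  obtain ⟨b, hb, hspan, hli⟩ := exists_linearIndependent K (Set.range M.row)
  have hcard : Module.finrank K (Submodule.span K b) = M.rank := by
    rw [hspan, ← Matrix.rank_eq_finrank_span_row]
  have hbf : b.Finite := (Set.finite_range _).subset hb
  have := hbf.fintype
  have hbc : Fintype.card b = M.rank := by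
    rw [← hcard]
    have := finrank_span_eq_card hli
    rw [Subtype.range_coe] at this
    exact this.symm
  choose g hg using fun x : b => hb x.2
  have hginj : Function.Injective g := fun x y hxy => Subtype.ext (by rw [← hg x, ← hg y, hxy])
  obtain ⟨t, htsub, ht⟩ := Finset.exists_subset_card_eq
    (s := Finset.univ.image g) (n := i) (by
      rw [Finset.card_image_of_injective _ hginj, Finset.card_univ, hbc]; exact hi)
  refine ⟨t.orderEmbOfFin ht, ?_⟩
  have hli' : LinearIndependent K (M.submatrix (t.orderEmbOfFin ht) id).row := by
    have hmem : ∀ j, ∃ x : b, g x = t.orderEmbOfFin ht j := fun j => by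
      have := htsub (t.orderEmbOfFin_mem ht j)
      simpa using this
    choose f hf using hmem
    have : (M.submatrix (t.orderEmbOfFin ht) id).row = (fun x : b => (x : n → K)) ∘ f := by
      funext j
      change M.row (t.orderEmbOfFin ht j) = _
      rw [← hf, hg]
      rfl
    rw [this]
    refine hli.comp f fun x y hxy => (t.orderEmbOfFin ht).injective ?_
    rw [← hf, ← hf, hxy]
  rw [hli'.rank_matrix, Fintype.card_fin]

/-- The rank of a square matrix is at least `i` iff some `i`-minor does not vanish. -/
theorem le_rank_iff_exists_minor_ne_zero {s : ℕ} (M : Matrix (Fin s) (Fin s) K) (i : ℕ) :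
    i ≤ M.rank ↔ ∃ e f : Fin i ↪o Fin s, (M.submatrix e f).det ≠ 0 := by
  constructor
  · intro hi
    obtain ⟨e, he⟩ := exists_orderEmbedding_rank_submatrix M hi
    -- Choosing rows of the transpose chooses columns of the full-rank submatrix already found.
    rw [← Matrix.rank_transpose] at he
    obtain ⟨f, hf⟩ := exists_orderEmbedding_rank_submatrix _ he.ge
    refine ⟨e, f, ?_⟩
    have hr : (M.submatrix e f).rank = i := by
      rw [← Matrix.rank_transpose]; exact hf
    have hli : LinearIndependent K (M.submatrix e f).row := by
      rw [linearIndependent_iff_card_eq_finrank_span, Set.finrank,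
        ← Matrix.rank_eq_finrank_span_row]
      simpa using hr.symm
    exact ((Matrix.isUnit_iff_isUnit_det _).1
      (Matrix.linearIndependent_rows_iff_isUnit.1 hli)).ne_zero
  · rintro ⟨e, f, hd⟩
    have h1 : (M.submatrix e f).rank = i := by
      rw [Matrix.rank_of_isUnit _ ((Matrix.isUnit_iff_isUnit_det _).2 hd.isUnit), Fintype.card_fin]
    rw [← h1]
    exact M.rank_submatrix_le _ _

/-- Minors commute with specialization along `g`. The boundary cases are included: the `0`-minor is
`1`, and for `i > s` there are no minors, so the ideal is zero. -/
theorem minorIdeal_le_ker_iff {A : Type*} [CommRing A] {s : ℕ} (H : Matrix (Fin s) (Fin s) A)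
    (g : A →+* K) (i : ℕ) : minorIdeal H i ≤ RingHom.ker g ↔ (H.map g).rank < i := by
  rw [← not_le, le_rank_iff_exists_minor_ne_zero, minorIdeal, Ideal.span_le]
  push Not
  constructor
  · intro h e f
    rw [Matrix.submatrix_map, ← RingHom.mapMatrix_apply, ← RingHom.map_det]
    exact h ⟨e, f, rfl⟩
  · rintro h _ ⟨e, f, rfl⟩
    have := h e f
    rwa [Matrix.submatrix_map, ← RingHom.mapMatrix_apply, ← RingHom.map_det] at this

end Minors

/-! ### Generic freeness by division with remainder -/

section GenericFreeness

open MvPolynomial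

universe u v u' v'

variable {A : Type u} {B : Type v} [CommRing A] [CommRing B] [Algebra A B]

/-- Dickson's lemma for the leading exponents of the elements of an ideal. -/
theorem exists_finset_degree_le {σ : Type*} [Finite σ] (mo : MonomialOrder σ)
    (I : Ideal (MvPolynomial σ A)) :
    ∃ G : Finset (MvPolynomial σ A), (∀ g ∈ G, g ∈ I ∧ g ≠ 0) ∧
      ∀ f ∈ I, f ≠ 0 → ∃ g ∈ G, mo.degree g ≤ mo.degree f := by
  classical
  let E : Set (σ →₀ ℕ) := {d | ∃ f ∈ I, f ≠ 0 ∧ mo.degree f = d}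
  have hfin : {d | Minimal (· ∈ E) d}.Finite :=
    WellQuasiOrderedLE.finite_of_isAntichain (setOfPred_minimal_antichain _)
  have hG : ∀ d : {d | Minimal (· ∈ E) d}, ∃ f ∈ I, f ≠ 0 ∧ mo.degree f = d := fun d => d.2.1
  choose F hFI hF0 hFd using hG
  have := hfin.fintype
  refine ⟨Finset.univ.image F, ?_, fun f hf hf0 => ?_⟩
  · intro g hg
    obtain ⟨d, -, rfl⟩ := Finset.mem_image.1 hg
    exact ⟨hFI d, hF0 d⟩
  · have hE : mo.degree f ∈ E := ⟨f, hf, hf0, rfl⟩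
    obtain ⟨d, hd, hmin⟩ := exists_minimal_le_of_wellFoundedLT (· ∈ E) _ hE
    exact ⟨F ⟨d, hmin⟩, Finset.mem_image_of_mem _ (Finset.mem_univ _), by rw [hFd]; exact hd⟩

/-- **Generic freeness.** -/
theorem exists_free_localization [IsDomain A] {m : ℕ} (φ : MvPolynomial (Fin m) A →ₐ[A] B)
    (hφ : Function.Surjective φ) :
    ∃ w : A, w ≠ 0 ∧ ∀ (A' : Type u') (B' : Type v') [CommRing A'] [CommRing B'] [Algebra A A']
      [Algebra B B'] [Algebra A' B'] [Algebra A B'] [IsScalarTower A A' B'] [IsScalarTower A B B']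
      [IsLocalization (Submonoid.powers w) A']
      [IsLocalization (Algebra.algebraMapSubmonoid B (Submonoid.powers w)) B'],
      Module.Free A' B' := by
  classical
  let mo : MonomialOrder (Fin m) := MonomialOrder.lex
  obtain ⟨G, hGI, hG⟩ := exists_finset_degree_le mo (RingHom.ker φ)
  -- Inverting this product makes every leading coefficient of `G` a unit, which is what division by
  -- `G` needs.
  set w := ∏ g ∈ G, mo.leadingCoeff g with hw
  have hw0 : w ≠ 0 := Finset.prod_ne_zero_iff.2 fun g hg =>
    mo.leadingCoeff_ne_zero_iff.2 (hGI g hg).2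
  refine ⟨w, hw0, ?_⟩
  intro A' B' _ _ _ _ _ _ _ _ _ _
  -- The standard monomials, divisible by no leading monomial of `G`; their images are going to be
  -- the basis.
  let Std : Type _ := {d : Fin m →₀ ℕ // ∀ g ∈ G, ¬ mo.degree g ≤ d}
  let v : Std → B := fun d => φ (monomial d.1 1)
  have hv : LinearIndependent A v := by
    rw [linearIndependent_iff]
    intro l hl
    set f := Finsupp.linearCombination A (fun d : Std => (monomial d.1 (1 : A))) l with hf
    have hcoeff : ∀ d, f.coeff d = l.mapDomain Subtype.val d := by
      intro d
      rw [hf, Finsupp.linearCombination_apply, Finsupp.sum, coeff_sum, Finsupp.mapDomain,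
        Finsupp.sum, Finsupp.finsetSum_apply]
      refine Finset.sum_congr rfl fun e _ => ?_
      simp [coeff_monomial, Finsupp.single_apply]
    have hker : f ∈ RingHom.ker φ := by
      rw [RingHom.mem_ker, hf, ← AlgHom.toLinearMap_apply,
        Finsupp.apply_linearCombination A φ.toLinearMap]
      exact hl
    have hf0 : f = 0 := by
      by_contra hne
      obtain ⟨g, hg, hle⟩ := hG f hker hne
      -- A relation is an element of the kernel, so its leading exponent is not standard; but only
      -- standard exponents occur in it.
      refine mo.coeff_degree_ne_zero_iff.2 hne ?_
      rw [hcoeff]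
      exact Finsupp.mapDomain_of_notMem_range _ _ fun ⟨d, hd⟩ => d.2 g hg (hd ▸ hle)
    apply Finsupp.mapDomain_injective Subtype.val_injective
    ext d
    rw [← hcoeff, hf0]
    simp
  have : IsLocalizedModule (Submonoid.powers w) (IsScalarTower.toAlgHom A B B').toLinearMap :=
    isLocalizedModule_iff_isLocalization.2 inferInstance
  have hv' := hv.of_isLocalizedModule A' (Submonoid.powers w)
    (IsScalarTower.toAlgHom A B B').toLinearMap
  refine Module.Free.of_basis (Module.Basis.mk hv' ?_)
  have hinj : Function.Injective (algebraMap A A') :=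
    IsLocalization.injective A' (powers_le_nonZeroDivisors_of_noZeroDivisors hw0)
  let ψ : MvPolynomial (Fin m) A' →ₐ[A'] B' := aeval fun i => algebraMap B B' (φ (X i))
  have hψ : ∀ f, ψ (map (algebraMap A A') f) = algebraMap B B' (φ f) := by
    intro f
    have : ((ψ : MvPolynomial (Fin m) A' →+* B').comp (map (algebraMap A A'))) =
        (algebraMap B B').comp (φ : MvPolynomial (Fin m) A →+* B) := by
      refine MvPolynomial.ringHom_ext (fun a => ?_) fun i => ?_
      · have : φ (C a) = algebraMap A B a := φ.commutes a
        simp [ψ, this, ← IsScalarTower.algebraMap_apply]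
      · simp [ψ]
    exact DFunLike.congr_fun this f
  have hdeg : ∀ f : MvPolynomial (Fin m) A, mo.degree (map (algebraMap A A') f) = mo.degree f := by
    intro f
    simp [MonomialOrder.degree, support_map_of_injective _ hinj]
  have hspan : ∀ f, ψ f ∈ Submodule.span A'
      (Set.range ((IsScalarTower.toAlgHom A B B').toLinearMap ∘ v)) := by
    intro f
    -- The divisors die in `B'`, so `f` may be replaced by its remainder, which involves standard
    -- monomials only.
    obtain ⟨q, r, hfr, -, hr⟩ := mo.div (b := fun g : G => map (algebraMap A A') g.1) (fun g => by
      rw [MonomialOrder.leadingCoeff, hdeg, coeff_map]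
      refine isUnit_of_dvd_unit (map_dvd _ (Finset.dvd_prod_of_mem mo.leadingCoeff g.2))
        (IsLocalization.map_units A' (⟨w, Submonoid.mem_powers w⟩ : Submonoid.powers w))) f
    have h1 : ψ f = ψ r := by
      rw [hfr, map_add, Finsupp.linearCombination_apply, Finsupp.sum, map_sum,
        Finset.sum_eq_zero, zero_add]
      intro g _
      have : φ g.1 = 0 := (hGI g.1 g.2).1
      rw [smul_eq_mul, map_mul, hψ, this, map_zero, mul_zero]
    rw [h1, r.as_sum, map_sum]
    refine Submodule.sum_mem _ fun d hd => ?_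
    have h2 : monomial d (coeff d r) = coeff d r • map (algebraMap A A') (monomial d 1) := by
      simp [smul_monomial]
    rw [h2, map_smul, hψ]
    refine Submodule.smul_mem _ _ (Submodule.subset_span ⟨⟨d, fun g hg => ?_⟩, rfl⟩)
    have := hr d hd ⟨g, hg⟩
    rwa [hdeg] at this
  intro b' _
  obtain ⟨⟨b, ⟨_, s, hs, rfl⟩⟩, hb⟩ :=
    IsLocalization.surj (Algebra.algebraMapSubmonoid B (Submonoid.powers w)) b'
  obtain ⟨f, rfl⟩ := hφ b
  obtain ⟨u, hu⟩ := IsLocalization.map_units A' (⟨s, hs⟩ : Submonoid.powers w)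
  have : b' = (↑u⁻¹ : A') • ψ (map (algebraMap A A') f) := by
    rw [hψ, ← hb, ← IsScalarTower.algebraMap_apply, IsScalarTower.algebraMap_apply A A' B', ← hu,
      mul_comm, ← Algebra.smul_def, smul_smul, Units.inv_mul, one_smul]
  rw [this]
  exact Submodule.smul_mem _ _ (hspan _)

end GenericFreeness

/-! ### Points over an algebraically closed field -/

section AlgClosed

variable {L S : Type*} [Field L] [CommRing S] [Algebra L S]

/-- Nullstellensatz: the residue field at `P` is finite over `L`, hence maps to `L`. -/
theorem exists_algHom_ker_eq [IsAlgClosed L] [Algebra.FiniteType L S] (P : Ideal S)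
    [hP : P.IsMaximal] :
    ∃ φ : S →ₐ[L] L, RingHom.ker φ = P := by
  let := Ideal.Quotient.field P
  have : Module.Finite L (S ⧸ P) := finite_of_finite_type_of_isJacobsonRing L (S ⧸ P)
  let ψ : (S ⧸ P) →ₐ[L] L := IsAlgClosed.lift
  let φ : S →ₐ[L] L := ψ.comp (Ideal.Quotient.mkₐ L P)
  refine ⟨φ, (hP.eq_of_le (RingHom.ker_ne_top _) fun x hx => ?_).symm⟩
  have : (Ideal.Quotient.mkₐ L P) x = 0 := Ideal.Quotient.eq_zero_iff_mem.2 hx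
  rw [RingHom.mem_ker]
  simp only [φ, AlgHom.comp_apply, this, map_zero]

/-- The value `φ x` is the only scalar `c` for which `x - c` lies in the kernel. -/
theorem algHom_ker_injective : Function.Injective fun φ : S →ₐ[L] L => RingHom.ker φ := by
  intro φ ψ h
  ext x
  have h1 : x - algebraMap L S (φ x) ∈ RingHom.ker φ := by simp [RingHom.mem_ker]
  rw [show RingHom.ker φ = RingHom.ker ψ from h, RingHom.mem_ker] at h1
  rw [map_sub, AlgHom.commutes, Algebra.algebraMap_self, RingHom.id_apply, sub_eq_zero] at h1
  exact h1.symm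

theorem algHom_ker_isMaximal (φ : S →ₐ[L] L) : (RingHom.ker φ).IsMaximal :=
  RingHom.ker_isMaximal_of_surjective φ fun c => ⟨algebraMap L S c, by simp⟩

/-- A Jacobson ring with finite spectrum has discrete spectrum, hence dimension at most zero; being
Noetherian, `S` is then Artinian and so finite over `L`. -/
theorem finite_of_finite_primeSpectrum [Algebra.FiniteType L S] [Finite (PrimeSpectrum S)] :
    Module.Finite L S := by
  rw [Module.finite_iff_isArtinianRing, isArtinianRing_iff_isNoetherianRing_krullDimLE_zero]
  have : IsJacobsonRing S := isJacobsonRing_of_finiteType (A := L)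
  exact ⟨Algebra.FiniteType.isNoetherianRing L _,
    (PrimeSpectrum.discreteTopology_iff_finite_and_krullDimLE_zero.mp inferInstance).right⟩

/-- Points correspond to maximal ideals. If there are finitely many, then in a Jacobson ring a prime
is a finite intersection of maximal ideals, hence is one of them. If there are infinitely many, both
sides are `⊤`, although non-maximal primes may exist. -/
theorem card_primeSpectrum_eq_card_algHom [IsAlgClosed L] [Algebra.FiniteType L S] :
    ENat.card (PrimeSpectrum S) = ENat.card (S →ₐ[L] L) := by
  classical
  let F : (S →ₐ[L] L) → PrimeSpectrum S :=
    fun φ => ⟨RingHom.ker φ, (algHom_ker_isMaximal φ).isPrime⟩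
  have hF : Function.Injective F := fun φ ψ h =>
    algHom_ker_injective (congrArg PrimeSpectrum.asIdeal h)
  rcases finite_or_infinite (S →ₐ[L] L) with hfin | hinf
  · have : Fintype (S →ₐ[L] L) := Fintype.ofFinite _
    refine (ENat.card_congr (Equiv.ofBijective F ⟨hF, fun P => ?_⟩)).symm
    have hJ : IsJacobsonRing S := isJacobsonRing_of_finiteType (A := L)
    -- The value `⊤` removes the points outside `V(P)` from the intersection.
    have hle : (Finset.univ.inf fun φ : S →ₐ[L] L =>
        if P.asIdeal ≤ RingHom.ker φ then RingHom.ker φ else ⊤) ≤ P.asIdeal := by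
      conv_rhs => rw [← hJ.out P.2.isRadical]
      refine le_sInf fun M hM => ?_
      have := hM.2
      obtain ⟨φ, hφ⟩ := exists_algHom_ker_eq (L := L) M
      refine (Finset.inf_le (Finset.mem_univ φ)).trans ?_
      rw [if_pos (hφ ▸ hM.1), hφ]
    obtain ⟨φ, -, hφ⟩ := (P.2.inf_le').1 hle
    refine ⟨φ, PrimeSpectrum.ext ?_⟩
    split_ifs at hφ with h1
    · exact le_antisymm hφ h1
    · exact absurd (top_le_iff.1 hφ) P.2.ne_top
  · rw [ENat.card_eq_top.2 hinf, ENat.card_eq_top.2 (Infinite.of_injective F hF)]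

end AlgClosed

/-! ### The Hermite trace form counts points -/

section Hermite

variable {L S : Type*} [Field L] [CommRing S] [Algebra L S]

/-- In characteristic zero, an element `z` is nilpotent if all its multiples have trace zero. -/
theorem isNilpotent_of_trace_mul_eq_zero [CharZero L] [Module.Finite L S] (z : S)
    (hz : ∀ y, Algebra.trace L S (z * y) = 0) : IsNilpotent z := by
  have : IsArtinianRing S := IsArtinianRing.of_finite L S
  -- The powers of `z` stabilize up to multiples, which yields an idempotent `e` generating the same
  -- ideal as `z ^ n`.
  obtain ⟨n, hn⟩ := IsArtinian.exists_pow_succ_smul_dvd z (1 : S)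
  obtain ⟨y, hy⟩ := hn
  rw [smul_eq_mul, smul_eq_mul, mul_one] at hy
  have hpow : ∀ j : ℕ, ∃ t, z ^ n = z ^ (n + j) * t := by
    intro j
    induction j with
    | zero => exact ⟨1, by simp⟩
    | succ j ih =>
      obtain ⟨t, ht⟩ := ih
      refine ⟨y * t, ?_⟩
      calc z ^ n = z ^ (n + j) * t := ht
        _ = z ^ j * z ^ n * t := by ring
        _ = z ^ j * (z ^ n.succ * y) * t := by rw [hy]
        _ = _ := by rw [Nat.succ_eq_add_one]; ring
  obtain ⟨t, ht⟩ := hpow (n + 1)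
  set e := z ^ (n + 1) * t with he
  have hze : z ^ n * e = z ^ n := by
    conv_rhs => rw [ht]
    rw [he, pow_add z n (n + 1), mul_assoc]
  have hee : e * e = e := by
    calc e * e = z * t * (z ^ n * e) := by rw [he]; ring
      _ = e := by rw [hze, he]; ring
  have htr : LinearMap.trace L S (Algebra.lmul L S e) = 0 := by
    rw [← hz (z ^ n * t), Algebra.trace_apply, he]
    congr 2
    ring
  have h0 : Algebra.lmul L S e = 0 := by
    -- The trace of an idempotent is its rank, and characteristic zero lets the rank be read off in
    -- `L`.
    refine (LinearMap.IsIdempotentElem.trace_eq_zero_iff ?_).1 htr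
    rw [IsIdempotentElem, ← map_mul, hee]
  have : e = 0 := by simpa using congrArg (fun f => f 1) h0
  exact ⟨n, by rw [← hze, this, mul_zero]⟩

variable [IsAlgClosed L]

/-- Evaluation at the points with `h ≠ 0` is onto by the Chinese remainder theorem, and its kernel
is the radical of the form `(x, y) ↦ tr (x h y)`. Rank-nullity for both maps then equates the number
of points with the rank. -/
theorem card_algHom_eq_rank_hermiteMatrix [Module.Finite L S] [CharZero L] {s : ℕ}
    (b : Module.Basis (Fin s) L S) (h : S) :
    ENat.card {φ : S →ₐ[L] L // φ h ≠ 0} = (hermiteMatrix b h).rank := by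
  classical
  have : IsArtinianRing S := IsArtinianRing.of_finite L S
  have : Fintype {φ : S →ₐ[L] L // φ h ≠ 0} := Fintype.ofFinite _
  let ψ : S →ₗ[L] ({φ : S →ₐ[L] L // φ h ≠ 0} → L) := LinearMap.pi fun φ => φ.1.toLinearMap
  have hψ : Function.Surjective ψ := by
    intro c
    have hco : Pairwise (Function.onFun IsCoprime
        fun φ : {φ : S →ₐ[L] L // φ h ≠ 0} => RingHom.ker φ.1) := by
      intro φ χ hne
      have := algHom_ker_isMaximal φ.1
      have := algHom_ker_isMaximal χ.1
      refine Ideal.isCoprime_of_isMaximal fun h => hne (Subtype.ext (algHom_ker_injective h))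
    obtain ⟨x, hx⟩ := Ideal.pi_quotient_surjective hco
      fun φ => Ideal.Quotient.mk _ (algebraMap L S (c φ))
    refine ⟨x, funext fun φ => ?_⟩
    have := (Ideal.Quotient.mk_eq_mk_iff_sub_mem _ _).1 (hx φ)
    rw [RingHom.mem_ker, map_sub, AlgHom.commutes, sub_eq_zero] at this
    exact this
  have hker : ∀ x : S, ψ x = 0 ↔ ∀ y, Algebra.trace L S (y * h * x) = 0 := by
    intro x
    constructor
    · intro hx y
      -- Every point kills `h` or kills `x`, so the product lies in all primes; nilpotent elements
      -- have trace zero.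
      have hnil : IsNilpotent (y * h * x) := by
        rw [← mem_nilradical, nilradical_eq_sInf]
        refine Ideal.mem_sInf.2 fun {P} hP => ?_
        have hPm : P.IsMaximal := by
          have : P.IsPrime := hP
          infer_instance
        obtain ⟨φ, rfl⟩ := exists_algHom_ker_eq (L := L) P
        rw [RingHom.mem_ker, map_mul, map_mul]
        by_cases h0 : φ h = 0
        · simp [h0]
        · have : φ x = 0 := congrFun hx ⟨φ, h0⟩
          simp [this]
      exact (Algebra.isNilpotent_trace_of_isNilpotent hnil).eq_zero
    · intro hx
      have hnil : IsNilpotent (h * x) := isNilpotent_of_trace_mul_eq_zero (L := L) _ fun y => by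
        rw [mul_comm, ← mul_assoc]; exact hx y
      funext φ
      have h1 : φ.1 h * φ.1 x = 0 := by
        rw [← map_mul]; exact (hnil.map φ.1).eq_zero
      exact (mul_eq_zero.1 h1).resolve_left φ.2
  have hmat : LinearMap.ker ψ = (LinearMap.ker (hermiteMatrix b h).mulVecLin).comap
      b.equivFun.toLinearMap := by
    ext x
    rw [LinearMap.mem_ker, hker, Submodule.mem_comap, LinearMap.mem_ker, Matrix.mulVecLin_apply]
    have hexp : ∀ i, (hermiteMatrix b h).mulVec (b.equivFun x) i =
        Algebra.trace L S (b i * h * x) := by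
      intro i
      conv_rhs => rw [← b.sum_equivFun x, Finset.mul_sum, map_sum]
      rw [Matrix.mulVec, dotProduct]
      refine Finset.sum_congr rfl fun j _ => ?_
      rw [mul_smul_comm, map_smul, smul_eq_mul, mul_comm]
      rfl
    constructor
    · intro hx
      funext i
      exact (hexp i).trans (hx _)
    · intro hx y
      rw [← b.sum_equivFun y, Finset.sum_mul, Finset.sum_mul, map_sum]
      refine Finset.sum_eq_zero fun i _ => ?_
      rw [smul_mul_assoc, smul_mul_assoc, map_smul, ← hexp]
      have := congrFun hx i
      simp only [LinearEquiv.coe_coe] at this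
      rw [this]; simp
  have h1 := LinearMap.finrank_range_add_finrank_ker ψ
  have h2 := LinearMap.finrank_range_add_finrank_ker (hermiteMatrix b h).mulVecLin
  have h3 : Module.finrank L (LinearMap.ker ψ) =
      Module.finrank L (LinearMap.ker (hermiteMatrix b h).mulVecLin) := by
    rw [hmat]
    exact (b.equivFun.ofSubmodule' _).finrank_eq
  rw [LinearMap.range_eq_top.2 hψ, finrank_top, Module.finrank_fintype_fun_eq_card] at h1
  rw [Module.finrank_fintype_fun_eq_card, Fintype.card_fin] at h2
  rw [Module.finrank_eq_card_basis b, Fintype.card_fin] at h1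
  rw [Matrix.rank, ENat.card_eq_coe_fintype_card]
  norm_cast
  omega

end Hermite

/-! ### Passage to geometric fibers -/

section BaseChange

variable {A B L : Type*} [CommRing A] [CommRing B] [Algebra A B] [Field L] [Algebra A L]

theorem trace_one_tmul [Module.Finite A B] [Module.Free A B] (x : B) :
    Algebra.trace L (L ⊗[A] B) (1 ⊗ₜ x) = algebraMap A L (Algebra.trace A B x) := by
  rw [Algebra.trace_apply, Algebra.trace_apply, ← LinearMap.trace_baseChange]
  congr 1
  ext y
  simp

/-- Basis and trace form are compatible with base change to `L`, and the `A`-homomorphisms from `B`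
to `L` are the `L`-points of `L ⊗[A] B`. -/
theorem rank_hermiteMatrix_map [IsAlgClosed L] [CharZero L] {s : ℕ}
    (b : Module.Basis (Fin s) A B) (h : B) :
    ENat.card {φ : B →ₐ[A] L // φ h ≠ 0} = ((hermiteMatrix b h).map (algebraMap A L)).rank := by
  let b' : Module.Basis (Fin s) L (L ⊗[A] B) := b.baseChange L
  have : Module.Finite L (L ⊗[A] B) := Module.Finite.of_basis b'
  have : Module.Finite A B := Module.Finite.of_basis b
  have : Module.Free A B := Module.Free.of_basis b
  have hH : (hermiteMatrix b h).map (algebraMap A L) = hermiteMatrix b' (1 ⊗ₜ h) := by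
    ext i j
    simp [hermiteMatrix, b', trace_one_tmul]
  rw [hH, ← card_algHom_eq_rank_hermiteMatrix]
  refine ENat.card_congr ((Algebra.TensorProduct.liftEquivRight A L B L).subtypeEquiv fun φ => ?_)
  simp

/-- With finitely many points the fiber algebra would be finite-dimensional, yet the base change of
`b` is an infinite basis of it. -/
theorem infinite_algHom [IsAlgClosed L] [Algebra.FiniteType A B] {ι : Type*} [Infinite ι]
    (b : Module.Basis ι A B) : Infinite (B →ₐ[A] L) := by
  rw [(Algebra.TensorProduct.liftEquivRight A L B L).infinite_iff]
  by_contra hfin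
  have : Finite (PrimeSpectrum (L ⊗[A] B)) := by
    rw [← ENat.card_lt_top, card_primeSpectrum_eq_card_algHom (L := L), ENat.card_lt_top]
    exact not_infinite_iff_finite.1 hfin
  have : Module.Finite L (L ⊗[A] B) := finite_of_finite_primeSpectrum
  exact not_finite_iff_infinite.2 ‹Infinite ι› (Module.Finite.finite_basis (b.baseChange L))

theorem geomFiberCard_eq_card_algHom [Algebra.FiniteType A B] (y : PrimeSpectrum A) :
    geomFiberCard A B y = ENat.card (B →ₐ[A] AlgebraicClosure y.asIdeal.ResidueField) := by
  let L := AlgebraicClosure y.asIdeal.ResidueField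
  let e : (B ⊗[A] L) ≃ₐ[A] (L ⊗[A] B) := Algebra.TensorProduct.comm A B L
  rw [geomFiberCard, ENat.card_congr (PrimeSpectrum.comapEquiv e.toRingEquiv).toEquiv,
    card_primeSpectrum_eq_card_algHom (L := L)]
  exact (ENat.card_congr (Algebra.TensorProduct.liftEquivRight A L B L)).symm

end BaseChange

theorem ker_algebraMap_algebraicClosure {A : Type*} [CommRing A] (y : PrimeSpectrum A) :
    RingHom.ker (algebraMap A (AlgebraicClosure y.asIdeal.ResidueField)) = y.asIdeal := by
  rw [IsScalarTower.algebraMap_eq A y.asIdeal.ResidueField, ← RingHom.comap_ker,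
    (RingHom.injective_iff_ker_eq_bot _).1 (algebraMap y.asIdeal.ResidueField _).injective,
    ← RingHom.ker_eq_comap_bot, Ideal.ker_algebraMap_residueField]

theorem nontrivial_tensorProduct_iff {K L M : Type*} [Field K] [Field L] [Algebra K L]
    [AddCommGroup M] [Module K M] : Nontrivial (L ⊗[K] M) ↔ Nontrivial M := by
  refine ⟨fun h => ?_, fun h => Module.FaithfullyFlat.lTensor_nontrivial K L M⟩
  by_contra h0
  rw [not_nontrivial_iff_subsingleton] at h0
  exact not_subsingleton (L ⊗[K] M) inferInstance

/-- The geometric fiber over `y` is nonempty iff `y` lies in the image. -/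
theorem geomFiberCard_ne_zero_iff {A B : Type*} [CommRing A] [CommRing B] [Algebra A B]
    (y : PrimeSpectrum A) :
    geomFiberCard A B y ≠ 0 ↔ y ∈ Set.range (PrimeSpectrum.comap (algebraMap A B)) := by
  rw [geomFiberCard, Ne, ENat.card_eq_zero_iff_empty, not_isEmpty_iff,
    PrimeSpectrum.nonempty_iff_nontrivial, ← PrimeSpectrum.nontrivial_iff_mem_rangeComap]
  let κ := y.asIdeal.ResidueField
  let L := AlgebraicClosure κ
  let e : L ⊗[κ] (κ ⊗[A] B) ≃ₗ[A] B ⊗[A] L :=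
    (((TensorProduct.AlgebraTensorModule.cancelBaseChange A κ κ L B).restrictScalars A).trans
      (TensorProduct.comm A L B))
  change Nontrivial (B ⊗[A] L) ↔ Nontrivial (κ ⊗[A] B)
  rw [← e.nontrivial_congr]
  exact nontrivial_tensorProduct_iff

/-! ### Fibers as solution sets in affine space -/

namespace Input

variable {k : Type*} [Field k] {n : ℕ} (p : Input k n)

section Points

variable (L : Type*) [Field L] [Algebra (BaseRing k n) L]

/-- The `L`-valued points of `U`. -/
def points : Set (Fin p.m → L) :=
  {x | (∀ f ∈ p.I, MvPolynomial.aeval x f = 0) ∧ MvPolynomial.aeval x p.h ≠ 0}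

/-- The quotient map from the coordinate ring of `𝔸ᵐ⁺ⁿ` to that of `X`. -/
def quotX : TotalRing k n p.m →ₐ[BaseRing k n] p.RingX :=
  { p.toRingX with commutes' := fun _ => rfl }

theorem quotX_surjective : Function.Surjective p.quotX := Ideal.Quotient.mk_surjective

theorem quotX_eq_zero {f : TotalRing k n p.m} (hf : f ∈ p.I) : p.quotX f = 0 :=
  Ideal.Quotient.eq_zero_iff_mem.2 hf

instance : Algebra.FiniteType (BaseRing k n) p.RingX :=
  Algebra.FiniteType.of_surjective p.quotX p.quotX_surjective

instance : Algebra.FiniteType (BaseRing k n) p.RingU :=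
  Algebra.FiniteType.trans (S := p.RingX) inferInstance
    (IsLocalization.finiteType_of_monoid_fg (Submonoid.powers (p.toRingX p.h)) _)

variable {L} in
/-- The homomorphism `Γ(X, 𝒪_X) → L` of a point. -/
def evalX (x : Fin p.m → L) (hx : ∀ f ∈ p.I, MvPolynomial.aeval x f = 0) :
    p.RingX →+* L :=
  Ideal.Quotient.lift p.I (MvPolynomial.aeval x : TotalRing k n p.m →ₐ[BaseRing k n] L).toRingHom hx

variable {L} in
theorem evalX_toRingX (x : Fin p.m → L) (hx : ∀ f ∈ p.I, MvPolynomial.aeval x f = 0)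
    (f : TotalRing k n p.m) : p.evalX x hx (p.toRingX f) = MvPolynomial.aeval x f := rfl

theorem card_algHom_ringU : ENat.card (p.RingU →ₐ[BaseRing k n] L) = ENat.card (p.points L) := by
  -- A homomorphism is evaluation at the images of the coordinates.
  have hq : ∀ (φ : p.RingU →ₐ[BaseRing k n] L) f,
      φ (algebraMap p.RingX p.RingU (p.quotX f)) =
      MvPolynomial.aeval
        (fun i => φ (algebraMap p.RingX p.RingU (p.quotX (MvPolynomial.X i)))) f := by
    intro φ f
    have : (φ.comp ((IsScalarTower.toAlgHom (BaseRing k n) p.RingX p.RingU).comp p.quotX)) =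
      MvPolynomial.aeval (fun i =>
        φ (algebraMap p.RingX p.RingU (p.quotX (MvPolynomial.X i)))) := by
      ext i
      simp
    exact DFunLike.congr_fun this f
  refine ENat.card_congr (Equiv.ofBijective (fun φ =>
    ⟨fun i => φ (algebraMap p.RingX p.RingU (p.quotX (MvPolynomial.X i))), ?_, ?_⟩) ⟨?_, ?_⟩)
  · intro f hf
    rw [← hq, p.quotX_eq_zero hf, map_zero, map_zero]
  · rw [← hq]
    exact ((IsLocalization.Away.algebraMap_isUnit (p.toRingX p.h)).map φ).ne_zero
  · intro φ χ h
    have h' := congrArg Subtype.val h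
    refine AlgHom.coe_ringHom_injective (IsLocalization.ringHom_ext
      (Submonoid.powers (p.toRingX p.h)) ?_)
    ext r
    obtain ⟨f, rfl⟩ := p.quotX_surjective r
    have h1 := hq φ f
    have h2 := hq χ f
    simp only at h'
    rw [h'] at h1
    exact h1.trans h2.symm
  · rintro ⟨x, hx, hxh⟩
    let g : p.RingU →+* L := IsLocalization.Away.lift (p.toRingX p.h) (g := p.evalX x hx) (by
      rw [evalX_toRingX]
      exact hxh.isUnit)
    have hg : ∀ r, g (algebraMap p.RingX p.RingU r) = p.evalX x hx r := fun r =>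
      IsLocalization.Away.lift_eq _ _ r
    refine ⟨{ g with commutes' := fun a => ?_ }, ?_⟩
    · change g (algebraMap (BaseRing k n) p.RingU a) = _
      rw [IsScalarTower.algebraMap_apply (BaseRing k n) p.RingX p.RingU, hg]
      exact (MvPolynomial.aeval_C x a)
    · ext i
      change g (algebraMap p.RingX p.RingU (p.toRingX (MvPolynomial.X i))) = x i
      rw [hg, evalX_toRingX, MvPolynomial.aeval_X]

theorem fiberCard_eq_card_points (y : PrimeSpectrum (BaseRing k n)) :
    p.fiberCard y = ENat.card (p.points (AlgebraicClosure y.asIdeal.ResidueField)) := by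
  rw [fiberCard, geomFiberCard_eq_card_algHom, card_algHom_ringU]

theorem algebraMap_toRingX_C (w : p.RingY) (a : BaseRing k n) :
    algebraMap p.RingX (p.RingB w) (p.toRingX (MvPolynomial.C a)) =
      algebraMap (p.RingA w) (p.RingB w) (algebraMap p.RingY (p.RingA w) (p.toRingY a)) := by
  rw [← IsScalarTower.algebraMap_apply p.RingY (p.RingA w) (p.RingB w),
    IsScalarTower.algebraMap_apply p.RingY p.RingX (p.RingB w)]
  rfl

/-- By `hL` the base point lies over `D(w)`, so `w` is already a unit in `L` and localization loses
no points. -/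
theorem card_algHom_ringB (w : p.RingY) [Algebra (p.RingA w) L]
    (hL : (algebraMap (p.RingA w) L).comp ((algebraMap p.RingY (p.RingA w)).comp p.toRingY) =
      algebraMap (BaseRing k n) L) :
    ENat.card {φ : p.RingB w →ₐ[p.RingA w] L //
      φ (algebraMap p.RingX (p.RingB w) (p.toRingX p.h)) ≠ 0} = ENat.card (p.points L) := by
  have hq : ∀ (φ : p.RingB w →ₐ[p.RingA w] L) f,
      φ (algebraMap p.RingX (p.RingB w) (p.toRingX f)) =
      MvPolynomial.aeval (fun i =>
        φ (algebraMap p.RingX (p.RingB w) (p.toRingX (MvPolynomial.X i)))) f := by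
    intro φ f
    have : (((φ : p.RingB w →+* L).comp (algebraMap p.RingX (p.RingB w))).comp p.toRingX) =
      ((MvPolynomial.aeval (fun i =>
        φ (algebraMap p.RingX (p.RingB w) (p.toRingX (MvPolynomial.X i)))) :
          TotalRing k n p.m →ₐ[BaseRing k n] L) : TotalRing k n p.m →+* L) := by
      refine MvPolynomial.ringHom_ext (fun a => ?_) fun i => ?_
      · have := DFunLike.congr_fun hL a
        simp only [RingHom.comp_apply, RingHom.coe_coe, algebraMap_toRingX_C, AlgHom.commutes]
        rw [MvPolynomial.aeval_C]
        exact this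
      · simp
    exact DFunLike.congr_fun this f
  refine ENat.card_congr (Equiv.ofBijective (fun φ =>
    ⟨fun i => φ.1 (algebraMap p.RingX (p.RingB w) (p.toRingX (MvPolynomial.X i))), ?_, ?_⟩)
    ⟨?_, ?_⟩)
  · intro f hf
    rw [← hq, show p.toRingX f = 0 from p.quotX_eq_zero hf, map_zero, map_zero]
  · rw [← hq]
    exact φ.2
  · intro φ χ h
    have h' := congrArg Subtype.val h
    refine Subtype.ext (AlgHom.coe_ringHom_injective (IsLocalization.ringHom_ext
      (Algebra.algebraMapSubmonoid p.RingX (Submonoid.powers w)) ?_))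
    ext r
    obtain ⟨f, rfl⟩ := p.quotX_surjective r
    have h1 := hq φ.1 f
    have h2 := hq χ.1 f
    simp only at h'
    rw [h'] at h1
    exact h1.trans h2.symm
  · rintro ⟨x, hx, hxh⟩
    have hY : ∀ a : p.RingY, p.evalX x hx (algebraMap p.RingY p.RingX a) =
        algebraMap (p.RingA w) L (algebraMap p.RingY (p.RingA w) a) := by
      intro a
      obtain ⟨a, rfl⟩ := Ideal.Quotient.mk_surjective a
      exact (MvPolynomial.aeval_C x a).trans (DFunLike.congr_fun hL a).symm
    let g : p.RingB w →+* L := IsLocalization.lift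
      (M := Algebra.algebraMapSubmonoid p.RingX (Submonoid.powers w)) (g := p.evalX x hx) (by
      rintro ⟨_, a, ha, rfl⟩
      rw [hY]
      exact (IsLocalization.map_units (p.RingA w) (⟨a, ha⟩ : Submonoid.powers w)).map _)
    have hg : ∀ r, g (algebraMap p.RingX (p.RingB w) r) = p.evalX x hx r := fun r =>
      IsLocalization.lift_eq _ r
    have hcomm : g.comp (algebraMap (p.RingA w) (p.RingB w)) = algebraMap (p.RingA w) L := by
      refine IsLocalization.ringHom_ext (Submonoid.powers w) ?_
      ext a
      rw [RingHom.comp_apply, RingHom.comp_apply,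
        ← IsScalarTower.algebraMap_apply p.RingY (p.RingA w) (p.RingB w),
        IsScalarTower.algebraMap_apply p.RingY p.RingX (p.RingB w), hg, hY]
      rfl
    refine ⟨⟨{ g with commutes' := DFunLike.congr_fun hcomm }, ?_⟩, ?_⟩
    · change g (algebraMap p.RingX (p.RingB w) (p.toRingX p.h)) ≠ 0
      rw [hg, evalX_toRingX]
      exact hxh
    · ext i
      change g (algebraMap p.RingX (p.RingB w) (p.toRingX (MvPolynomial.X i))) = x i
      rw [hg, evalX_toRingX, MvPolynomial.aeval_X]

/-- The extra equations come from the base, and by `hP` they hold identically over `L`. -/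
theorem points_restrict (P : Ideal (BaseRing k n))
    (hP : P ≤ RingHom.ker (algebraMap (BaseRing k n) L)) :
    (p.restrict P).points L = p.points L := by
  ext x
  change (∀ f ∈ p.I ⊔ P.map MvPolynomial.C, _) ∧ _ ↔ (∀ f ∈ p.I, _) ∧ _
  refine and_congr_left fun _ => ?_
  have : P.map MvPolynomial.C ≤ RingHom.ker
      (MvPolynomial.aeval x : TotalRing k n p.m →ₐ[BaseRing k n] L) := by
    rw [Ideal.map_le_iff_le_comap]
    intro a ha
    have : algebraMap (BaseRing k n) L a = 0 := hP ha
    simpa [RingHom.mem_ker] using this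
  change p.I ⊔ P.map MvPolynomial.C ≤ RingHom.ker
      (MvPolynomial.aeval x : TotalRing k n p.m →ₐ[BaseRing k n] L) ↔
    p.I ≤ RingHom.ker (MvPolynomial.aeval x : TotalRing k n p.m →ₐ[BaseRing k n] L)
  rw [sup_le_iff, and_iff_left this]

/-- The last coordinate is determined by the others as the inverse of the value of `h`. -/
theorem card_points_rabinowitsch :
    ENat.card (p.rabinowitsch.points L) = ENat.card (p.points L) := by
  have hev : ∀ (x : Fin (p.m + 1) → L) f,
      MvPolynomial.aeval x (MvPolynomial.rename (Fin.castSucc : Fin p.m → _) f : TotalRing k n _) =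
      MvPolynomial.aeval (fun i : Fin p.m => x i.castSucc) f := by
    intro x f
    rw [MvPolynomial.aeval_rename]
    rfl
  have hmem : ∀ x : Fin (p.m + 1) → L, x ∈ p.rabinowitsch.points L ↔
      (∀ f ∈ p.I, MvPolynomial.aeval (fun i : Fin p.m => x i.castSucc) f = 0) ∧
      x (Fin.last p.m) * MvPolynomial.aeval (fun i : Fin p.m => x i.castSucc) p.h = 1 := by
    intro x
    have h1 : x ∈ p.rabinowitsch.points L ↔ p.rabinowitschIdeal ≤ RingHom.ker
        (MvPolynomial.aeval x : TotalRing k n (p.m + 1) →ₐ[BaseRing k n] L) :=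
      and_iff_left (by change MvPolynomial.aeval x (1 : TotalRing k n (p.m + 1)) ≠ 0; simp)
    rw [h1, rabinowitschIdeal, sup_le_iff, Ideal.map_le_iff_le_comap, Ideal.span_singleton_le_iff_mem]
    refine and_congr ⟨fun h f hf => ?_, fun h f hf => ?_⟩ ?_
    · rw [← hev]; exact h hf
    · have := h f hf
      rw [← hev] at this
      exact this
    · rw [RingHom.mem_ker, map_sub, map_mul, hev, map_one, sub_eq_zero, MvPolynomial.aeval_X]
  refine (ENat.card_congr (Equiv.subtypeEquivRight hmem)).trans ?_
  refine ENat.card_congr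
    { toFun := fun x => ⟨fun i => x.1 i.castSucc, x.2.1, fun h0 => ?_⟩
      invFun := fun x => ⟨Fin.snoc (α := fun _ => L) x.1 (MvPolynomial.aeval x.1 p.h)⁻¹, ?_⟩
      left_inv := fun x => ?_
      right_inv := fun x => ?_ }
  · have := x.2.2
    rw [h0, mul_zero] at this
    exact zero_ne_one this
  · simp only [Fin.snoc_castSucc, Fin.snoc_last]
    exact ⟨x.2.1, inv_mul_cancel₀ x.2.2⟩
  · obtain ⟨x, hx⟩ := x
    refine Subtype.ext (funext fun i => ?_)
    refine Fin.lastCases ?_ (fun i => ?_) i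
    · simp only [Fin.snoc_last]
      exact (eq_inv_of_mul_eq_one_left hx.2).symm
    · simp only [Fin.snoc_castSucc]
  · exact Subtype.ext (funext fun i => by simp only [Fin.snoc_castSucc])

end Points

theorem fiberCard_restrict {P : Ideal (BaseRing k n)} {y : PrimeSpectrum (BaseRing k n)}
    (hy : y ∈ PrimeSpectrum.zeroLocus (P : Set (BaseRing k n))) :
    (p.restrict P).fiberCard y = p.fiberCard y := by
  rw [fiberCard_eq_card_points, fiberCard_eq_card_points, points_restrict]
  · rfl
  · rw [ker_algebraMap_algebraicClosure]
    exact hy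

theorem fiberCard_rabinowitsch (y : PrimeSpectrum (BaseRing k n)) :
    p.rabinowitsch.fiberCard y = p.fiberCard y := by
  rw [fiberCard_eq_card_points, fiberCard_eq_card_points, card_points_rabinowitsch]

theorem proj_image_X_subset : p.proj '' p.X ⊆ p.Y := by
  rintro _ ⟨x, hx, rfl⟩
  exact fun f hf => hx (p.le hf)

/-- The image of `U` consists of the points with nonempty geometric fiber. -/
theorem mem_proj_image_U_iff (y : PrimeSpectrum (BaseRing k n)) :
    y ∈ p.proj '' p.U ↔ p.fiberCard y ≠ 0 := by
  rw [fiberCard, geomFiberCard_ne_zero_iff]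
  have : algebraMap (BaseRing k n) p.RingU =
      (algebraMap p.RingX p.RingU).comp (p.toRingX.comp MvPolynomial.C) := rfl
  have hX : Set.range (PrimeSpectrum.comap p.toRingX) = p.X :=
    (_root_.range_comap_of_surjective _ _ Ideal.Quotient.mk_surjective).trans
      (congrArg _ (congrArg _ Ideal.mk_ker))
  have hU : Set.range (PrimeSpectrum.comap ((algebraMap p.RingX p.RingU).comp p.toRingX)) =
      p.U := by
    change Set.range (PrimeSpectrum.comap p.toRingX ∘
      PrimeSpectrum.comap (algebraMap p.RingX p.RingU)) = _
    rw [Set.range_comp, PrimeSpectrum.localization_away_comap_range _ (p.toRingX p.h), U, ← hX,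
      ← Set.image_preimage_eq_range_inter]
    rfl
  rw [← hU, ← Set.range_comp]
  rfl

end Input

/-- A free algebra of finite type with one finite fiber is finite. -/
theorem finite_preimage_singleton_iff_module_finite {A B : Type*} [CommRing A] [CommRing B]
    [Algebra A B] [Algebra.FiniteType A B] [Module.Free A B] (z : PrimeSpectrum A) :
    (PrimeSpectrum.comap (algebraMap A B) ⁻¹' {z}).Finite ↔ Module.Finite A B := by
  refine ⟨fun h => ?_, fun h => Algebra.QuasiFinite.finite_comap_preimage_singleton z⟩
  let κ := z.asIdeal.ResidueField
  have : Finite (PrimeSpectrum (κ ⊗[A] B)) :=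
    (PrimeSpectrum.preimageEquivFiber A B z).finite_iff.mp h
  have : Module.Finite κ (κ ⊗[A] B) := finite_of_finite_primeSpectrum
  -- Base change to the residue field keeps the index set of the basis, so finite dimension of one
  -- fiber bounds the rank of `B`.
  let b := Module.Free.chooseBasis A B
  have := Module.Finite.finite_basis (b.baseChange κ)
  exact Module.Finite.of_basis b

/-! ### Freeness away from `w` and the fibers over `D(w)` -/

namespace Input

variable {k : Type*} [Field k] {n : ℕ} (p : Input k n)

theorem isDomain_ringY (hp : p.Valid) : IsDomain p.RingY :=
  (Ideal.Quotient.isDomain_iff_prime p.J).2 hp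

theorem toRingY_surjective : Function.Surjective p.toRingY := Ideal.Quotient.mk_surjective

theorem toRingX_surjective : Function.Surjective p.toRingX := Ideal.Quotient.mk_surjective

theorem ker_toRingY : RingHom.ker p.toRingY = p.J := Ideal.mk_ker

theorem ker_toRingX : RingHom.ker p.toRingX = p.I := Ideal.mk_ker

theorem range_comap_toRingY : Set.range (PrimeSpectrum.comap p.toRingY) = p.Y := by
  rw [_root_.range_comap_of_surjective _ _ p.toRingY_surjective, ker_toRingY]
  rfl

theorem range_comap_toRingX : Set.range (PrimeSpectrum.comap p.toRingX) = p.X := by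
  rw [_root_.range_comap_of_surjective _ _ p.toRingX_surjective, ker_toRingX]
  rfl

theorem isClosedEmbedding_comap_toRingY :
    Topology.IsClosedEmbedding (PrimeSpectrum.comap p.toRingY) :=
  PrimeSpectrum.isClosedEmbedding_comap_of_surjective _ _ p.toRingY_surjective

/-- The presentation of the coordinate ring of `X` as an algebra over that of `Y`. -/
def presentation : MvPolynomial (Fin p.m) p.RingY →ₐ[p.RingY] p.RingX :=
  MvPolynomial.aeval fun i => p.toRingX (MvPolynomial.X i)

theorem presentation_surjective : Function.Surjective p.presentation := by
  intro r
  obtain ⟨f, rfl⟩ := p.toRingX_surjective r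
  refine ⟨MvPolynomial.map p.toRingY f, ?_⟩
  have : (p.presentation : _ →+* p.RingX).comp (MvPolynomial.map p.toRingY) = p.toRingX := by
    refine MvPolynomial.ringHom_ext (fun a => ?_) fun i => ?_
    · rw [RingHom.comp_apply, MvPolynomial.map_C]
      exact p.presentation.commutes _
    · rw [RingHom.comp_apply, MvPolynomial.map_X]
      exact MvPolynomial.aeval_X _ _
  exact DFunLike.congr_fun this f

instance : Algebra.FiniteType p.RingY p.RingX :=
  Algebra.FiniteType.of_surjective p.presentation p.presentation_surjective

instance (w : p.RingY) : Algebra.FiniteType (p.RingA w) (p.RingB w) := by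
  have : Monoid.FG (Algebra.algebraMapSubmonoid p.RingX (Submonoid.powers w)) :=
    (Monoid.fg_iff_submonoid_fg _).2 (((Monoid.fg_iff_submonoid_fg _).1 inferInstance).map _)
  have h1 : Algebra.FiniteType p.RingX (p.RingB w) :=
    IsLocalization.finiteType_of_monoid_fg
      (Algebra.algebraMapSubmonoid p.RingX (Submonoid.powers w)) _
  have h2 : Algebra.FiniteType p.RingY (p.RingB w) :=
    Algebra.FiniteType.trans (S := p.RingX) inferInstance h1
  exact Algebra.FiniteType.of_restrictScalars_finiteType p.RingY _ _

theorem exists_isFreeAway (hp : p.Valid) : ∃ w, p.IsFreeAway w := by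
  have := p.isDomain_ringY hp
  obtain ⟨w, hw0, hw⟩ := exists_free_localization p.presentation p.presentation_surjective
  exact ⟨w, hw0, hw (p.RingA w) (p.RingB w)⟩

section Loci

variable (w : p.RingY)

theorem locusD_subset : p.locusD w ⊆ p.Y := by
  rw [← range_comap_toRingY]
  exact Set.image_subset_range _ _

theorem locusV_subset : p.locusV w ⊆ p.Y := by
  rw [← range_comap_toRingY]
  exact Set.image_subset_range _ _

theorem mem_locusD_or_mem_locusV {y : PrimeSpectrum (BaseRing k n)} (hy : y ∈ p.Y) :
    y ∈ p.locusD w ∨ y ∈ p.locusV w := by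
  rw [← range_comap_toRingY] at hy
  obtain ⟨z, rfl⟩ := hy
  by_cases hw : w ∈ z.asIdeal
  · exact Or.inr ⟨z, by simpa [PrimeSpectrum.mem_zeroLocus] using hw, rfl⟩
  · exact Or.inl ⟨z, hw, rfl⟩

theorem isClosed_locusV : IsClosed (p.locusV w) :=
  p.isClosedEmbedding_comap_toRingY.isClosedMap _ (PrimeSpectrum.isClosed_zeroLocus _)

theorem isLocallyClosed_locusD : IsLocallyClosed (p.locusD w) :=
  (PrimeSpectrum.basicOpen w).isOpen.isLocallyClosed.image
    p.isClosedEmbedding_comap_toRingY.isInducing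
    p.isClosedEmbedding_comap_toRingY.isClosed_range.isLocallyClosed

theorem generic_notMem_locusV (hp : p.Valid) {w : p.RingY} (hw : w ≠ 0) :
    (⟨p.J, hp⟩ : PrimeSpectrum (BaseRing k n)) ∉ p.locusV w := by
  rintro ⟨z, hz, hzJ⟩
  obtain ⟨a, rfl⟩ := p.toRingY_surjective w
  refine hw ?_
  rw [← RingHom.mem_ker, ker_toRingY, ← show z.asIdeal.comap p.toRingY = p.J from
    congrArg PrimeSpectrum.asIdeal hzJ]
  exact hz rfl

/-- The immersion `Spec Γ(D(w), 𝒪_Y) → 𝔸ⁿ`. -/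
def immersion : PrimeSpectrum (p.RingA w) → PrimeSpectrum (BaseRing k n) :=
  PrimeSpectrum.comap ((algebraMap p.RingY (p.RingA w)).comp p.toRingY)

theorem immersion_eq_comp : p.immersion w =
    PrimeSpectrum.comap p.toRingY ∘ PrimeSpectrum.comap (algebraMap p.RingY (p.RingA w)) := rfl

theorem isEmbedding_immersion : Topology.IsEmbedding (p.immersion w) := by
  rw [immersion_eq_comp]
  exact p.isClosedEmbedding_comap_toRingY.isEmbedding.comp
    (PrimeSpectrum.localization_comap_isEmbedding _ (Submonoid.powers w))

theorem range_immersion : Set.range (p.immersion w) = p.locusD w := by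
  rw [immersion_eq_comp, Set.range_comp,
    PrimeSpectrum.localization_away_comap_range (p.RingA w) w]
  rfl

theorem rankLocus_subset {s : ℕ} (b : Module.Basis (Fin s) (p.RingA w) (p.RingB w)) (i : ℕ) :
    p.rankLocus w b i ⊆ p.locusD w := by
  rw [← range_immersion]
  exact Set.image_subset_range _ _

theorem isLocallyClosed_rankLocus {s : ℕ} (b : Module.Basis (Fin s) (p.RingA w) (p.RingB w))
    (i : ℕ) : IsLocallyClosed (p.rankLocus w b i) :=
  IsLocallyClosed.image ((PrimeSpectrum.isClosed_zeroLocus _).isLocallyClosed.inter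
      (PrimeSpectrum.isClosed_zeroLocus _).isOpen_compl.isLocallyClosed)
    (p.isEmbedding_immersion w).isInducing
    (by
      change IsLocallyClosed (Set.range (p.immersion w))
      rw [range_immersion]; exact p.isLocallyClosed_locusD w)

variable {w} {L : Type*} [Field L] [Algebra (BaseRing k n) L]

/-- Since `w` does not vanish at `y`, it becomes a unit in `L`; so the geometric point factors
through `Γ(D(w), 𝒪_Y)`, where the Hermite matrix can be specialized. -/
theorem exists_ringA_hom {y : PrimeSpectrum (BaseRing k n)}
    (hL : RingHom.ker (algebraMap (BaseRing k n) L) = y.asIdeal) (hy : y ∈ p.locusD w) :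
    ∃ g : p.RingA w →+* L,
      g.comp ((algebraMap p.RingY (p.RingA w)).comp p.toRingY) = algebraMap (BaseRing k n) L := by
  obtain ⟨z, hz, rfl⟩ := hy
  let gY : p.RingY →+* L := Ideal.Quotient.lift p.J (algebraMap (BaseRing k n) L) fun a ha => by
    rw [← RingHom.mem_ker, hL]
    change p.toRingY a ∈ z.asIdeal
    rw [← ker_toRingY, RingHom.mem_ker] at ha
    rw [ha]
    exact zero_mem _
  have hgY : ∀ a, gY (p.toRingY a) = algebraMap (BaseRing k n) L a := fun a => rfl
  have hw : IsUnit (gY w) := by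
    obtain ⟨a, rfl⟩ := p.toRingY_surjective w
    rw [hgY, isUnit_iff_ne_zero]
    intro h0
    rw [← RingHom.mem_ker, hL] at h0
    exact hz h0
  refine ⟨IsLocalization.Away.lift (S := p.RingA w) w hw, RingHom.ext fun a => ?_⟩
  exact (IsLocalization.Away.lift_eq w hw _).trans (hgY a)

theorem immersion_ker {y : PrimeSpectrum (BaseRing k n)}
    (hL : RingHom.ker (algebraMap (BaseRing k n) L) = y.asIdeal) (g : p.RingA w →+* L)
    (hg : g.comp ((algebraMap p.RingY (p.RingA w)).comp p.toRingY) =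
      algebraMap (BaseRing k n) L) :
    p.immersion w ⟨RingHom.ker g, RingHom.ker_isPrime g⟩ = y := by
  refine PrimeSpectrum.ext ?_
  rw [← hL, ← hg]
  rfl

theorem mem_rankLocus_iff {y : PrimeSpectrum (BaseRing k n)}
    (hL : RingHom.ker (algebraMap (BaseRing k n) L) = y.asIdeal) (g : p.RingA w →+* L)
    (hg : g.comp ((algebraMap p.RingY (p.RingA w)).comp p.toRingY) =
      algebraMap (BaseRing k n) L) {s : ℕ} (b : Module.Basis (Fin s) (p.RingA w) (p.RingB w))
    (i : ℕ) : y ∈ p.rankLocus w b i ↔ ((p.hermite w b).map g).rank = i := by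
  rw [← p.immersion_ker hL g hg]
  change p.immersion w _ ∈ p.immersion w '' _ ↔ _
  rw [(p.isEmbedding_immersion w).injective.mem_set_image, Set.mem_sdiff]
  change minorIdeal (p.hermite w b) (i + 1) ≤ RingHom.ker g ∧
    ¬ minorIdeal (p.hermite w b) i ≤ RingHom.ker g ↔ _
  rw [minorIdeal_le_ker_iff, minorIdeal_le_ker_iff]
  omega

variable [IsAlgClosed L]

theorem card_points_eq_rank [CharZero L] (g : p.RingA w →+* L)
    (hg : g.comp ((algebraMap p.RingY (p.RingA w)).comp p.toRingY) =
      algebraMap (BaseRing k n) L) {s : ℕ} (b : Module.Basis (Fin s) (p.RingA w) (p.RingB w)) :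
    ENat.card (p.points L) = ((p.hermite w b).map g).rank := by
  algebraize [g]
  rw [← p.card_algHom_ringB L w hg, rank_hermiteMatrix_map b]
  rfl

theorem card_points_eq_top (hU : p.U = p.X) (g : p.RingA w →+* L)
    (hg : g.comp ((algebraMap p.RingY (p.RingA w)).comp p.toRingY) =
      algebraMap (BaseRing k n) L) [Module.Free (p.RingA w) (p.RingB w)]
    (hfin : ¬ Module.Finite (p.RingA w) (p.RingB w)) :
    ENat.card (p.points L) = ⊤ := by
  algebraize [g]
  let b := Module.Free.chooseBasis (p.RingA w) (p.RingB w)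
  have : Infinite (Module.Free.ChooseBasisIndex (p.RingA w) (p.RingB w)) := by
    by_contra h
    rw [not_infinite_iff_finite] at h
    exact hfin (Module.Finite.of_basis b)
  have hinf : Infinite (p.RingB w →ₐ[p.RingA w] L) := infinite_algHom b
  rw [← p.card_algHom_ringB L w hg, ENat.card_eq_top]
  -- The condition on `h` is void: a point killing `h` would have as kernel a prime in `X` but not
  -- in `U`.
  refine (Equiv.subtypeUnivEquiv fun φ => ?_).infinite_iff.2 hinf
  intro h0
  let ψ : TotalRing k n p.m →+* L :=
    (φ : p.RingB w →+* L).comp ((algebraMap p.RingX (p.RingB w)).comp p.toRingX)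
  have hx : (⟨RingHom.ker ψ, RingHom.ker_isPrime ψ⟩ : PrimeSpectrum (TotalRing k n p.m)) ∈ p.X := by
    intro f hf
    have : p.toRingX f = 0 := p.quotX_eq_zero hf
    change ψ f = 0
    simp [ψ, this]
  rw [← hU] at hx
  exact hx.2 h0

end Loci

/-- The generic point of `Y` lies in `D(w)`, so its fiber in `X` is the generic fiber of `Spec B →
Spec A`. As `B` is free, that one fiber decides finiteness, hence the behavior over all of `D(w)`.
-/
theorem genericallyFinite_iff (hp : p.Valid) {w : p.RingY} (hw : p.IsFreeAway w) :
    p.GenericallyFinite ↔ Module.Finite (p.RingA w) (p.RingB w) := by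
  have := p.isDomain_ringY hp
  have := hw.2
  have hdom : IsDomain (p.RingA w) := IsLocalization.isDomain_localization
    (powers_le_nonZeroDivisors_of_noZeroDivisors hw.1)
  have hinjY : Function.Injective (algebraMap p.RingY (p.RingA w)) :=
    IsLocalization.injective _ (powers_le_nonZeroDivisors_of_noZeroDivisors hw.1)
  let M := Algebra.algebraMapSubmonoid p.RingX (Submonoid.powers w)
  let T : PrimeSpectrum (p.RingB w) → PrimeSpectrum (TotalRing k n p.m) :=
    PrimeSpectrum.comap ((algebraMap p.RingX (p.RingB w)).comp p.toRingX)
  have hT : Function.Injective T :=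
    (PrimeSpectrum.comap_injective_of_surjective _ p.toRingX_surjective).comp
      (PrimeSpectrum.localization_comap_injective (p.RingB w) M)
  have hcomp : ∀ u, p.proj (T u) =
      p.immersion w (PrimeSpectrum.comap (algebraMap (p.RingA w) (p.RingB w)) u) := by
    intro u
    have : (((algebraMap p.RingX (p.RingB w)).comp p.toRingX).comp MvPolynomial.C) =
        (algebraMap (p.RingA w) (p.RingB w)).comp
          ((algebraMap p.RingY (p.RingA w)).comp p.toRingY) := by
      exact RingHom.ext fun a => p.algebraMap_toRingX_C w a
    change PrimeSpectrum.comap (((algebraMap p.RingX (p.RingB w)).comp p.toRingX).comp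
      MvPolynomial.C) u = _
    rw [this]
    rfl
  have hbot : p.immersion w ⊥ = ⟨p.J, hp⟩ := by
    refine PrimeSpectrum.ext ?_
    change RingHom.ker ((algebraMap p.RingY (p.RingA w)).comp p.toRingY) = p.J
    rw [RingHom.ker_comp_of_injective _ hinjY, ker_toRingY]
  have himage : T '' (PrimeSpectrum.comap (algebraMap (p.RingA w) (p.RingB w)) ⁻¹' {⊥}) =
      {x | x ∈ p.X ∧ (p.proj x).asIdeal = p.J} := by
    ext x
    constructor
    · rintro ⟨u, hu, rfl⟩
      refine ⟨?_, ?_⟩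
      · rw [← range_comap_toRingX]
        exact ⟨PrimeSpectrum.comap (algebraMap p.RingX (p.RingB w)) u, rfl⟩
      · rw [hcomp, show PrimeSpectrum.comap _ u = ⊥ from hu, hbot]
    · rintro ⟨hx, hxJ⟩
      rw [← range_comap_toRingX] at hx
      obtain ⟨v, rfl⟩ := hx
      -- A prime over the generic point contracts to zero on `Y`, so it contains no power of `w` and
      -- survives localization.
      have hv : v ∈ Set.range (PrimeSpectrum.comap (algebraMap p.RingX (p.RingB w))) := by
        rw [PrimeSpectrum.localization_comap_range _ M]
        change Disjoint (M : Set p.RingX) v.asIdeal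
        rw [Set.disjoint_left]
        rintro _ ⟨_, ⟨j, rfl⟩, rfl⟩ hj
        have hwj : w ∈ v.asIdeal.comap (algebraMap p.RingY p.RingX) :=
          Ideal.IsPrime.mem_of_pow_mem inferInstance j hj
        refine hw.1 ?_
        obtain ⟨a, rfl⟩ := p.toRingY_surjective w
        rw [← RingHom.mem_ker, ker_toRingY, ← hxJ]
        exact hwj
      obtain ⟨u, rfl⟩ := hv
      refine ⟨u, (p.isEmbedding_immersion w).injective ?_, rfl⟩
      rw [← hcomp, hbot]
      exact PrimeSpectrum.ext hxJ
  rw [GenericallyFinite, ← himage, Set.finite_image_iff hT.injOn,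
    finite_preimage_singleton_iff_module_finite]

theorem charZero_algebraicClosure [CharZero k] (y : PrimeSpectrum (BaseRing k n)) :
    CharZero (AlgebraicClosure y.asIdeal.ResidueField) :=
  charZero_of_injective_ringHom
    ((algebraMap (BaseRing k n) (AlgebraicClosure y.asIdeal.ResidueField)).comp
      MvPolynomial.C).injective

theorem fiberCard_eq_top {w : p.RingY} (hp : p.Valid) (hw : p.IsFreeAway w)
    (hfin : ¬ p.GenericallyFinite) (hU : p.U = p.X) {y : PrimeSpectrum (BaseRing k n)}
    (hy : y ∈ p.locusD w) : p.fiberCard y = ⊤ := by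
  have := hw.2
  obtain ⟨g, hg⟩ := p.exists_ringA_hom (ker_algebraMap_algebraicClosure y) hy
  rw [fiberCard_eq_card_points]
  exact p.card_points_eq_top hU g hg (by rwa [← p.genericallyFinite_iff hp hw])

theorem mem_rankLocus_iff_fiberCard [CharZero k] {w : p.RingY} {s : ℕ}
    (b : Module.Basis (Fin s) (p.RingA w) (p.RingB w)) {y : PrimeSpectrum (BaseRing k n)}
    (hy : y ∈ p.locusD w) (i : ℕ) : y ∈ p.rankLocus w b i ↔ p.fiberCard y = i := by
  have := charZero_algebraicClosure y
  obtain ⟨g, hg⟩ := p.exists_ringA_hom (ker_algebraMap_algebraicClosure y) hy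
  rw [fiberCard_eq_card_points, p.card_points_eq_rank g hg b,
    p.mem_rankLocus_iff (ker_algebraMap_algebraicClosure y) g hg b, Nat.cast_inj]

theorem exists_fiberCard_eq_natCast [CharZero k] {w : p.RingY} {s : ℕ}
    (b : Module.Basis (Fin s) (p.RingA w) (p.RingB w)) {y : PrimeSpectrum (BaseRing k n)}
    (hy : y ∈ p.locusD w) : ∃ i ≤ s, p.fiberCard y = i := by
  have := charZero_algebraicClosure y
  obtain ⟨g, hg⟩ := p.exists_ringA_hom (ker_algebraMap_algebraicClosure y) hy
  refine ⟨_, ?_, (p.fiberCard_eq_card_points y).trans (p.card_points_eq_rank g hg b)⟩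
  exact Matrix.rank_le_height _

end Input

/-! ### Parts of an input and the descent of sizes -/

namespace Input

variable {k : Type*} [Field k] {n : ℕ}

open Classical in
/-- The size of an input, which drops in recursive calls. -/
def size (p : Input k n) : (Ideal (BaseRing k n))ᵒᵈ ×ₗ ℕ :=
  toLex (OrderDual.toDual p.J, if p.U = p.X then 0 else 1)

/-- `q` is a part of `p`, with the same geometric fibers. -/
def IsPart (q p : Input k n) : Prop :=
  q.Valid ∧ q.Y ⊆ p.Y ∧ ∀ y ∈ q.Y, q.fiberCard y = p.fiberCard y

variable (p : Input k n)

/-- The pair `c` is correct for `p`. -/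
def IsCorrect (c : Set (PrimeSpectrum (BaseRing k n)) × ℕ∞) : Prop :=
  IsLocallyClosed c.1 ∧ c.1 ⊆ p.Y ∧ (∀ y ∈ c.1, p.fiberCard y = c.2) ∧ c.2 ≠ 0

theorem exists_restrict_mem {Z : Set (PrimeSpectrum (BaseRing k n))} (hZ : IsClosed Z)
    {Ps : List (Ideal (BaseRing k n))} (hPs : IsComponentList Z Ps)
    {y : PrimeSpectrum (BaseRing k n)} (hy : y ∈ Z) : ∃ q ∈ Ps.map p.restrict, y ∈ q.Y := by
  obtain ⟨P, hP, hyP⟩ := hPs.exists_mem hZ hy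
  exact ⟨_, List.mem_map_of_mem hP, hyP⟩

/-- Each component lies in `Y`, so `J ≤ P`; equality would put the generic point into `Z`. -/
theorem restrict_isPart_and_size_lt (hp : p.Valid) {Z : Set (PrimeSpectrum (BaseRing k n))}
    (hZ : IsClosed Z) (hZY : Z ⊆ p.Y) (hgen : (⟨p.J, hp⟩ : PrimeSpectrum (BaseRing k n)) ∉ Z)
    {Ps : List (Ideal (BaseRing k n))} (hPs : IsComponentList Z Ps)
    {q : Input k n} (hq : q ∈ Ps.map p.restrict) : q.IsPart p ∧ q.size < p.size := by
  obtain ⟨P, hP, rfl⟩ := List.mem_map.1 hq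
  have hPZ := hPs.zeroLocus_subset hZ hP
  have hPp := hPs.isPrime hP
  refine ⟨⟨hPp, hPZ.trans hZY, fun y hy => p.fiberCard_restrict hy⟩, ?_⟩
  refine Prod.Lex.toLex_lt_toLex.2 (Or.inl ?_)
  change p.J < P
  have hle : p.J ≤ P := hZY (hPZ (show (⟨P, hPp⟩ : PrimeSpectrum (BaseRing k n)) ∈ _ from
    fun _ h => h))
  refine lt_of_le_of_ne hle fun h => hgen (hPZ ?_)
  exact h.ge

/-- The generic point specializes to every point of `Y`, so a closed set containing it contains `Y`.
-/
theorem generic_notMem_closure (hp : p.Valid) (h : closure (p.proj '' p.X) ≠ p.Y) :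
    (⟨p.J, hp⟩ : PrimeSpectrum (BaseRing k n)) ∉ closure (p.proj '' p.X) := by
  intro hmem
  refine h (Set.Subset.antisymm ?_ fun y hy => ?_)
  · exact closure_minimal p.proj_image_X_subset (PrimeSpectrum.isClosed_zeroLocus _)
  · have : (⟨p.J, hp⟩ : PrimeSpectrum (BaseRing k n)) ⤳ y :=
      (PrimeSpectrum.le_iff_specializes _ _).1 hy
    exact this.mem_closed isClosed_closure hmem

theorem rabinowitsch_isPart (hp : p.Valid) : p.rabinowitsch.IsPart p :=
  ⟨hp, subset_rfl, fun y _ => p.fiberCard_rabinowitsch y⟩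

/-- The ideal `J` stays, but the new `h` is `1`, so the second entry drops from `1` to `0`. -/
theorem rabinowitsch_size_lt (hU : p.U ≠ p.X) : p.rabinowitsch.size < p.size := by
  refine Prod.Lex.toLex_lt_toLex.2 (Or.inr ⟨rfl, ?_⟩)
  have h1 : p.rabinowitsch.U = p.rabinowitsch.X := by
    refine Set.inter_eq_left.2 fun x _ => ?_
    change (1 : TotalRing k n (p.m + 1)) ∉ x.asIdeal
    exact fun h => x.2.ne_top ((Ideal.eq_top_iff_one _).2 h)
  rw [if_pos h1, if_neg hU]
  exact Nat.zero_lt_one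

end Input

variable {k : Type*} [Field k] {n : ℕ}

/-- Needed to compare algebraic closures of the isomorphic residue fields of a point on `Y` and on
affine space. -/
theorem Input.card_points_congr (p : Input k n) {L L' : Type*} [Field L] [Field L']
    [Algebra (BaseRing k n) L] [Algebra (BaseRing k n) L'] (σ : L ≃ₐ[BaseRing k n] L') :
    ENat.card (p.points L) = ENat.card (p.points L') := by
  have h : ∀ (x : Fin p.m → L) f,
      MvPolynomial.aeval (fun i => σ (x i)) f = σ (MvPolynomial.aeval x f) := fun x f => by
    have := MvPolynomial.comp_aeval_apply (f := x) (σ : L →ₐ[BaseRing k n] L') f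
    exact this.symm
  refine ENat.card_congr ((Equiv.piCongrRight fun _ => σ.toEquiv).subtypeEquiv fun x => ?_)
  change (∀ f ∈ p.I, _) ∧ _ ↔ (∀ f ∈ p.I, MvPolynomial.aeval (fun i => σ (x i)) f = 0) ∧
    MvPolynomial.aeval (fun i => σ (x i)) p.h ≠ 0
  simp only [h, ne_eq, EmbeddingLike.map_eq_zero_iff]

/-! ### Execution of the body, the invariant of a run, termination and correctness -/

section Body

variable {p : Input k n} {out : Output k n} {calls : List (Input k n)}

theorem Body.isPart_and_size_lt (hp : p.Valid) (h : Body p out calls) :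
    ∀ q ∈ calls, q.IsPart p ∧ q.size < p.size := by
  intro q hq
  cases h with
  | empty => simp at hq
  | notDominant Ps h1 h2 h3 =>
    exact p.restrict_isPart_and_size_lt hp isClosed_closure
      (closure_minimal p.proj_image_X_subset (PrimeSpectrum.isClosed_zeroLocus _))
      (p.generic_notMem_closure hp h2) h3 hq
  | infiniteFibers w Ps h1 h2 h3 h4 h5 h6 =>
    exact p.restrict_isPart_and_size_lt hp (p.isClosed_locusV w) (p.locusV_subset w)
      (p.generic_notMem_locusV hp h3.1) h6 hq
  | rabinowitsch w h1 h2 h3 h4 h5 =>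
    obtain rfl := List.mem_singleton.1 hq
    exact ⟨p.rabinowitsch_isPart hp, p.rabinowitsch_size_lt h5⟩
  | finiteFibers w s b Ps h1 h2 h3 h4 h5 =>
    exact p.restrict_isPart_and_size_lt hp (p.isClosed_locusV w) (p.locusV_subset w)
      (p.generic_notMem_locusV hp h3.1) h5 hq

theorem Body.isCorrect [CharZero k] (hp : p.Valid) (h : Body p out calls) :
    ∀ c ∈ out, p.IsCorrect c := by
  intro c hc
  cases h with
  | empty => simp at hc
  | notDominant => simp at hc
  | infiniteFibers w Ps h1 h2 h3 h4 h5 h6 =>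
    obtain rfl := List.mem_singleton.1 hc
    exact ⟨p.isLocallyClosed_locusD w, p.locusD_subset w,
      fun y hy => p.fiberCard_eq_top hp h3 h4 h5 hy, ENat.top_ne_zero⟩
  | rabinowitsch => simp at hc
  | finiteFibers w s b Ps h1 h2 h3 h4 h5 =>
    obtain ⟨i, hi, rfl⟩ := List.mem_map.1 hc
    -- The labels start at `1`, so no pair labelled `0` is ever returned.
    have hi1 := (List.mem_range'_1.1 hi).1
    refine ⟨p.isLocallyClosed_rankLocus w b i,
      (p.rankLocus_subset w b i).trans (p.locusD_subset w), fun y hy => ?_, ?_⟩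
    · exact (p.mem_rankLocus_iff_fiberCard b (p.rankLocus_subset w b i hy) i).1 hy
    · exact Nat.cast_ne_zero.2 (by omega)

theorem Body.exists_mem [CharZero k] (h : Body p out calls)
    {y : PrimeSpectrum (BaseRing k n)} (hy : y ∈ p.Y) (hy0 : p.fiberCard y ≠ 0) :
    y ∈ covered out ∨ ∃ q ∈ calls, y ∈ q.Y := by
  have hX : y ∈ p.proj '' p.X :=
    Set.image_mono Set.inter_subset_left ((p.mem_proj_image_U_iff y).2 hy0)
  cases h with
  | empty h1 => simp [h1] at hX
  | notDominant Ps h1 h2 h3 =>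
    exact Or.inr (p.exists_restrict_mem isClosed_closure h3 (subset_closure hX))
  | infiniteFibers w Ps h1 h2 h3 h4 h5 h6 =>
    rcases p.mem_locusD_or_mem_locusV w hy with hD | hV
    · exact Or.inl ⟨_, List.mem_singleton_self _, hD⟩
    · exact Or.inr (p.exists_restrict_mem (p.isClosed_locusV w) h6 hV)
  | rabinowitsch w h1 h2 h3 h4 h5 => exact Or.inr ⟨_, List.mem_singleton_self _, hy⟩
  | finiteFibers w s b Ps h1 h2 h3 h4 h5 =>
    rcases p.mem_locusD_or_mem_locusV w hy with hD | hV
    · obtain ⟨i, his, hi⟩ := p.exists_fiberCard_eq_natCast b hD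
      have hi0 : i ≠ 0 := by rintro rfl; exact hy0 hi
      refine Or.inl ⟨_, List.mem_map_of_mem (a := i) (List.mem_range'_1.2 ⟨by omega, by omega⟩), ?_⟩
      exact (p.mem_rankLocus_iff_fiberCard b hD i).2 hi
    · exact Or.inr (p.exists_restrict_mem (p.isClosed_locusV w) h5 hV)

theorem exists_body (hp : p.Valid) : ∃ out calls, Body p out calls := by
  by_cases h1 : p.X = ∅
  · exact ⟨_, _, .empty h1⟩
  by_cases h2 : closure (p.proj '' p.X) = p.Y
  swap
  · obtain ⟨Ps, hPs⟩ := exists_isComponentList (A := BaseRing k n)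
      (isClosed_closure (s := p.proj '' p.X))
    exact ⟨_, _, .notDominant Ps h1 h2 hPs⟩
  obtain ⟨w, hw⟩ := p.exists_isFreeAway hp
  obtain ⟨Ps, hPs⟩ := exists_isComponentList (p.isClosed_locusV w)
  by_cases h3 : p.GenericallyFinite
  · have := hw.2
    have := (p.genericallyFinite_iff hp hw).1 h3
    obtain ⟨s, b⟩ : ∃ s, Nonempty (Module.Basis (Fin s) (p.RingA w) (p.RingB w)) := by
      let b := Module.Free.chooseBasis (p.RingA w) (p.RingB w)
      exact ⟨_, ⟨b.reindex (Fintype.equivFin _)⟩⟩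
    exact ⟨_, _, .finiteFibers w s b.some Ps h1 h2 hw h3 hPs⟩
  by_cases h4 : p.U = p.X
  · exact ⟨_, _, .infiniteFibers w Ps h1 h2 hw h3 h4 hPs⟩
  · exact ⟨_, _, .rabinowitsch w h1 h2 hw h3 h4⟩

end Body

/-- All pairs found so far are correct, all pending calls are parts of the original input, and all
points with nonempty geometric fiber are dealt with or belong to a pending call. -/
structure State.Sound (p : Input k n) (σ : State k n) : Prop where
  isCorrect : ∀ c ∈ σ.found, p.IsCorrect c
  isPart : ∀ q ∈ σ.pending, q.IsPart p
  exists_mem : ∀ y ∈ p.Y, p.fiberCard y ≠ 0 → y ∈ covered σ.found ∨ ∃ q ∈ σ.pending, y ∈ q.Y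

theorem State.sound_start {p : Input k n} (hp : p.Valid) : (start p).Sound p where
  isCorrect := by simp [start]
  isPart := by
    intro q hq
    obtain rfl := List.mem_singleton.1 hq
    exact ⟨hp, subset_rfl, fun _ _ => rfl⟩
  exists_mem := fun y hy _ => Or.inr ⟨p, List.mem_singleton_self _, hy⟩

theorem Step.sound [CharZero k] {p : Input k n} {σ τ : State k n} (h : Step σ τ)
    (hσ : σ.Sound p) : τ.Sound p := by
  obtain ⟨r, ps, calls, found, out, hb⟩ := h
  have hr : r.IsPart p := hσ.isPart r List.mem_cons_self
  refine ⟨fun c hc => ?_, fun q hq => ?_, fun y hy hy0 => ?_⟩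
  · rcases List.mem_append.1 hc with hc | hc
    · exact hσ.isCorrect c hc
    · obtain ⟨h1, h2, h3, h4⟩ := hb.isCorrect hr.1 c hc
      exact ⟨h1, h2.trans hr.2.1, fun y hy => by rw [← hr.2.2 y (h2 hy), h3 y hy], h4⟩
  · rcases List.mem_append.1 hq with hq | hq
    · obtain ⟨h1, h2, h3⟩ := (hb.isPart_and_size_lt hr.1 q hq).1
      exact ⟨h1, h2.trans hr.2.1, fun y hy => by rw [h3 y hy, hr.2.2 y (h2 hy)]⟩
    · exact hσ.isPart q (List.mem_cons_of_mem _ hq)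
  · have hcov : ∀ o ⊆ found ++ out, y ∈ covered o → y ∈ covered (found ++ out) :=
      fun o ho ⟨c, hc, hyc⟩ => ⟨c, ho hc, hyc⟩
    rcases hσ.exists_mem y hy hy0 with hc | ⟨q, hq, hyq⟩
    · exact Or.inl (hcov _ (List.subset_append_left _ _) hc)
    · rcases List.mem_cons.1 hq with rfl | hq
      · rcases hb.exists_mem hyq (by rwa [hr.2.2 y hyq]) with hc | ⟨q', hq', hyq'⟩
        · exact Or.inl (hcov _ (List.subset_append_right _ _) hc)
        · exact Or.inr ⟨q', List.mem_append_left _ hq', hyq'⟩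
      · exact Or.inr ⟨q, List.mem_append_right _ hq, hyq⟩

theorem Reaches.sound [CharZero k] {p : Input k n} (hp : p.Valid) {σ : State k n}
    (h : Reaches p σ) : σ.Sound p := by
  induction h with
  | refl => exact State.sound_start hp
  | tail _ hstep ih => exact hstep.sound ih

/-- The sizes of the pending calls. -/
def State.sizes (σ : State k n) : Multiset ((Ideal (BaseRing k n))ᵒᵈ ×ₗ ℕ) :=
  (σ.pending.map Input.size : List _)

/-- A step replaces the size of one call by finitely many smaller ones, which is a single move of
the multiset order. -/
theorem Step.cutExpand {σ τ : State k n} (h : Step σ τ) (hσ : ∀ q ∈ σ.pending, q.Valid) :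
    Relation.CutExpand (· < ·) τ.sizes σ.sizes := by
  obtain ⟨r, ps, calls, found, out, hb⟩ := h
  refine ⟨(calls.map Input.size : List _), r.size, fun a ha => ?_, ?_⟩
  · obtain ⟨q, hq, rfl⟩ := List.mem_map.1 (Multiset.mem_coe.1 ha)
    exact (hb.isPart_and_size_lt (hσ r List.mem_cons_self) q hq).2
  · simp only [State.sizes, List.map_append, List.map_cons, ← Multiset.coe_add,
      ← Multiset.cons_coe, ← Multiset.singleton_add]
    abel

/-- **Termination**. -/
theorem terminates [CharZero k] {p : Input k n} (hp : p.Valid) : Terminates p := by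
  refine ⟨?_, fun σ hσ hne => ?_⟩
  · rintro ⟨run, h0, hrun⟩
    have hreach : ∀ i, Reaches p (run i) := by
      intro i
      induction i with
      | zero => rw [h0]; exact .refl
      | succ i ih => exact ih.tail (hrun i)
    -- Ideals under reversed inclusion are well-founded because the base polynomial ring is
    -- Noetherian.
    have hwf : WellFounded ((· < ·) : (Ideal (BaseRing k n))ᵒᵈ ×ₗ ℕ → _ → Prop) := wellFounded_lt
    have hcut := hwf.cutExpand
    exact (wellFounded_iff_isEmpty_descending_chain.1 hcut).false
      ⟨fun i => (run i).sizes, fun i => (hrun i).cutExpand fun q hq =>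
        (((hreach i).sound hp).isPart q hq).1⟩
  · obtain ⟨_ | ⟨q, ps⟩, found⟩ := σ
    · exact absurd rfl hne
    · obtain ⟨out, calls, hb⟩ := exists_body ((hσ.sound hp).isPart q List.mem_cons_self).1
      exact ⟨_, .exec q ps calls found out hb⟩

/-- **Correctness**: the result of the algorithm on `p` classifies the geometric fibers of `p`. -/
theorem Returns.correct [CharZero k] {p : Input k n} (hp : p.Valid) {out : Output k n}
    (h : Returns p out) :
    (∀ c ∈ out, IsLocallyClosed c.1 ∧ c.1 ⊆ p.Y ∧ ∀ y ∈ c.1, p.fiberCard y = c.2) ∧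
      covered out = p.proj '' p.U ∧
      (∀ l : ℕ∞, l ≠ 0 → {y | y ∈ p.Y ∧ p.fiberCard y = l} = labelled out l) ∧
      {y | y ∈ p.Y ∧ p.fiberCard y = 0} = p.Y \ covered out := by
  have hs := Reaches.sound hp h
  have hcov : ∀ y ∈ p.Y, p.fiberCard y ≠ 0 → y ∈ covered out := fun y hy hy0 =>
    (hs.exists_mem y hy hy0).resolve_right (by simp)
  have hne : ∀ y ∈ covered out, p.fiberCard y ≠ 0 := by
    rintro y ⟨c, hc, hyc⟩
    obtain ⟨-, -, h3, h4⟩ := hs.isCorrect c hc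
    rw [h3 y hyc]
    exact h4
  refine ⟨fun c hc => ?_, ?_, fun l hl => ?_, ?_⟩
  · obtain ⟨h1, h2, h3, -⟩ := hs.isCorrect c hc
    exact ⟨h1, h2, h3⟩
  · ext y
    rw [p.mem_proj_image_U_iff]
    refine ⟨hne y, fun hy => hcov y ?_ hy⟩
    exact p.proj_image_X_subset
      (Set.image_mono Set.inter_subset_left ((p.mem_proj_image_U_iff y).2 hy))
  · ext y
    constructor
    · rintro ⟨hy, rfl⟩
      obtain ⟨c, hc, hyc⟩ := hcov y hy hl
      exact ⟨c, hc, ((hs.isCorrect c hc).2.2.1 y hyc).symm, hyc⟩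
    · rintro ⟨c, hc, rfl, hyc⟩
      exact ⟨(hs.isCorrect c hc).2.1 hyc, (hs.isCorrect c hc).2.2.1 y hyc⟩
  · ext y
    refine and_congr_right fun hy => ⟨fun h0 hc => hne y hc h0, fun hc => ?_⟩
    by_contra h0
    exact hc (hcov y hy h0)

/-! ### Arbitrary morphisms of affine varieties -/

section Embedding

variable {A B : Type*} [CommRing A] [CommRing B] [Algebra k A] [Algebra k B] [Algebra A B]

theorem exists_embedding [IsScalarTower k A B] [Algebra.FiniteType k A] [Algebra.FiniteType k B] :
    ∃ n m : ℕ, Nonempty (Embedding k A B n m) := by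
  obtain ⟨n, α, hα⟩ := Algebra.FiniteType.iff_quotient_mvPolynomial''.1
    (inferInstance : Algebra.FiniteType k A)
  obtain ⟨m, γ, hγ⟩ := Algebra.FiniteType.iff_quotient_mvPolynomial''.1
    (inferInstance : Algebra.FiniteType k B)
  -- The graph construction: base coordinates act through `α`, fiber coordinates are generators of
  -- `B` over `k`, so `β` is onto already on polynomials with constant coefficients.
  let β : TotalRing k n m →ₐ[k] B :=
    { MvPolynomial.eval₂Hom ((algebraMap A B).comp (α : BaseRing k n →+* A))
        (fun i => γ (MvPolynomial.X i)) with
      commutes' := fun c => by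
        change MvPolynomial.eval₂ _ _ (MvPolynomial.C (MvPolynomial.C c)) = _
        rw [MvPolynomial.eval₂_C]
        change algebraMap A B (α (algebraMap k _ c)) = _
        rw [α.commutes, ← IsScalarTower.algebraMap_apply] }
  refine ⟨n, m, ⟨⟨α, β, hα, fun b => ?_, fun f => MvPolynomial.eval₂_C _ _ _⟩⟩⟩
  obtain ⟨f, rfl⟩ := hγ b
  refine ⟨MvPolynomial.map MvPolynomial.C f, ?_⟩
  have : (β : TotalRing k n m →+* B).comp (MvPolynomial.map MvPolynomial.C) = γ := by
    refine MvPolynomial.ringHom_ext (fun c => ?_) fun i => ?_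
    · rw [RingHom.comp_apply, MvPolynomial.map_C]
      exact (β.commutes c).trans (γ.commutes c).symm
    · rw [RingHom.comp_apply, MvPolynomial.map_X]
      exact MvPolynomial.eval₂_X _ _ _
  exact DFunLike.congr_fun this f

namespace Embedding

variable {m : ℕ} (e : Embedding k A B n m)

theorem input_valid [IsDomain A] : e.input.Valid := RingHom.ker_isPrime _

theorem comap_mem_Y (y : PrimeSpectrum A) :
    PrimeSpectrum.comap (e.α : BaseRing k n →+* A) y ∈ e.input.Y := by
  intro f hf
  have : e.α f = 0 := hf
  change e.α f ∈ y.asIdeal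
  rw [this]
  exact zero_mem _

theorem card_points_input {L : Type*} [Field L] [Algebra A L] [Algebra (BaseRing k n) L]
    (h : (algebraMap A L).comp (e.α : BaseRing k n →+* A) = algebraMap (BaseRing k n) L) :
    ENat.card (e.input.points L) = ENat.card (B →ₐ[A] L) := by
  have hq : ∀ (φ : B →ₐ[A] L) f,
      φ (e.β f) = MvPolynomial.aeval (fun i => φ (e.β (MvPolynomial.X i))) f := by
    intro φ f
    have : (φ : B →+* L).comp (e.β : TotalRing k n m →+* B) =
      ((MvPolynomial.aeval (fun i => φ (e.β (MvPolynomial.X i))) :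
          TotalRing k n m →ₐ[BaseRing k n] L) : TotalRing k n m →+* L) := by
      refine MvPolynomial.ringHom_ext (fun a => ?_) fun i => ?_
      · simp only [RingHom.comp_apply, RingHom.coe_coe, e.comm, AlgHom.commutes]
        rw [MvPolynomial.aeval_C]
        exact DFunLike.congr_fun h a
      · simp
    exact DFunLike.congr_fun this f
  have hmem : ∀ φ : B →ₐ[A] L, (fun i => φ (e.β (MvPolynomial.X i))) ∈ e.input.points L := by
    refine fun φ => ⟨fun f hf => ?_, ?_⟩
    · have : e.β f = 0 := hf
      exact (hq φ f).symm.trans (by rw [this, map_zero])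
    · change MvPolynomial.aeval _ (1 : TotalRing k n m) ≠ 0
      simp
  refine (ENat.card_congr (Equiv.ofBijective (fun φ => ⟨_, hmem φ⟩) ⟨?_, ?_⟩)).symm
  · intro φ χ hφχ
    have h' : (fun i => φ (e.β (MvPolynomial.X i))) = fun i => χ (e.β (MvPolynomial.X i)) :=
      congrArg Subtype.val hφχ
    ext b
    obtain ⟨f, rfl⟩ := e.surjective_β b
    rw [hq, hq, h']
  · rintro ⟨x, hx, -⟩
    let ev : TotalRing k n m →+* L :=
      ((MvPolynomial.aeval x : TotalRing k n m →ₐ[BaseRing k n] L) : TotalRing k n m →+* L)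
    let g : B →+* L := (e.β : TotalRing k n m →+* B).liftOfSurjective e.surjective_β ⟨ev, hx⟩
    have hg : ∀ f, g (e.β f) = ev f := fun f =>
      RingHom.liftOfRightInverse_comp_apply _ _ _ ⟨ev, hx⟩ f
    refine ⟨{ g with commutes' := fun a => ?_ }, ?_⟩
    · obtain ⟨a, rfl⟩ := e.surjective_α a
      change g (algebraMap A B (e.α a)) = _
      rw [← e.comm, hg]
      exact (MvPolynomial.aeval_C x a).trans (DFunLike.congr_fun h a).symm
    · refine Subtype.ext (funext fun i => ?_)
      exact (hg _).trans (MvPolynomial.aeval_X x i)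

theorem fiberCard_input [Algebra.FiniteType A B] (y : PrimeSpectrum A) :
    e.input.fiberCard (PrimeSpectrum.comap (e.α : BaseRing k n →+* A) y) =
      geomFiberCard A B y := by
  rw [geomFiberCard_eq_card_algHom, Input.fiberCard_eq_card_points]
  let α : BaseRing k n →+* A := (e.α : BaseRing k n →+* A)
  -- A closed immersion induces isomorphisms of residue fields; the isomorphism is then extended to
  -- the algebraic closures.
  have hbij := (RingHom.surjectiveOnStalks_of_surjective (f := α) e.surjective_α)
    |>.residueFieldMap_bijective (PrimeSpectrum.comap α y).asIdeal y.asIdeal rfl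
  let ε := RingEquiv.ofBijective _ hbij
  let σ := IsAlgClosure.equivOfEquiv
    (AlgebraicClosure (PrimeSpectrum.comap α y).asIdeal.ResidueField)
    (AlgebraicClosure y.asIdeal.ResidueField) ε
  let : Algebra (BaseRing k n) (AlgebraicClosure y.asIdeal.ResidueField) :=
    ((algebraMap A _).comp α).toAlgebra
  rw [← e.card_points_input (L := AlgebraicClosure y.asIdeal.ResidueField) rfl]
  refine e.input.card_points_congr (AlgEquiv.ofRingEquiv (f := σ) fun a => ?_)
  rw [IsScalarTower.algebraMap_apply (BaseRing k n)
    (PrimeSpectrum.comap α y).asIdeal.ResidueField, IsAlgClosure.equivOfEquiv_algebraMap]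
  exact (congrArg _ (Ideal.ResidueField.map_algebraMap _ _ α rfl a)).trans
    (IsScalarTower.algebraMap_apply A y.asIdeal.ResidueField _ (α a)).symm

end Embedding

end Embedding

end FiberClassification

end

theorem mainTheorem3 {k : Type*} [Field k] [CharZero k] :
    -- the algorithm is correct on every input
    (∀ (n : ℕ) (p : FiberClassification.Input k n), p.Valid →
      FiberClassification.Terminates p ∧
      ∀ out : FiberClassification.Output k n, FiberClassification.Returns p out →
        (∀ c ∈ out, IsLocallyClosed c.1 ∧ c.1 ⊆ p.Y ∧ ∀ y ∈ c.1, p.fiberCard y = c.2) ∧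
        FiberClassification.covered out = p.proj '' p.U ∧
        (∀ l : ℕ∞, l ≠ 0 →
          {y | y ∈ p.Y ∧ p.fiberCard y = l} = FiberClassification.labelled out l) ∧
        {y | y ∈ p.Y ∧ p.fiberCard y = 0} = p.Y \ FiberClassification.covered out) ∧
    -- it classifies the geometric fibers of every morphism `Spec B → Spec A` of affine varieties
    (∀ (A B : Type*) [CommRing A] [IsDomain A] [CommRing B] [Algebra k A] [Algebra k B]
      [Algebra A B] [IsScalarTower k A B] [Algebra.FiniteType k A] [Algebra.FiniteType k B],
      (∃ n m : ℕ, Nonempty (FiberClassification.Embedding k A B n m)) ∧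
      ∀ (n m : ℕ) (e : FiberClassification.Embedding k A B n m),
        e.input.Valid ∧ FiberClassification.Terminates e.input ∧
        ∀ out : FiberClassification.Output k n, FiberClassification.Returns e.input out →
          (∀ l : ℕ∞, l ≠ 0 →
            {y : PrimeSpectrum A | FiberClassification.geomFiberCard A B y = l} =
              PrimeSpectrum.comap (e.α : FiberClassification.BaseRing k n →+* A) ⁻¹'
                FiberClassification.labelled out l) ∧
          {y : PrimeSpectrum A | FiberClassification.geomFiberCard A B y = 0} =
            (PrimeSpectrum.comap (e.α : FiberClassification.BaseRing k n →+* A) ⁻¹'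
              FiberClassification.covered out)ᶜ) := by
  refine ⟨fun n p hp => ⟨FiberClassification.terminates hp, fun out h => h.correct hp⟩, ?_⟩
  intro A B _ _ _ _ _ _ _ _ _
  refine ⟨FiberClassification.exists_embedding, fun n m e =>
    ⟨e.input_valid, FiberClassification.terminates e.input_valid, fun out h => ?_⟩⟩
  have : Algebra.FiniteType A B := Algebra.FiniteType.of_restrictScalars_finiteType k A B
  obtain ⟨-, -, h3, h4⟩ := h.correct e.input_valid
  refine ⟨fun l hl => ?_, ?_⟩
  · ext y
    rw [Set.mem_preimage, ← h3 l hl, Set.mem_ofPred_eq, Set.mem_ofPred_eq, e.fiberCard_input,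
      and_iff_right (e.comap_mem_Y y)]
  · ext y
    have := Set.ext_iff.1 h4 (PrimeSpectrum.comap (e.α : FiberClassification.BaseRing k n →+* A) y)
    rw [Set.mem_ofPred_eq, Set.mem_sdiff, and_iff_right (e.comap_mem_Y y),
      and_iff_right (e.comap_mem_Y y), e.fiberCard_input] at this
    rw [Set.mem_compl_iff, Set.mem_preimage, Set.mem_ofPred_eq, this]
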